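/- Let $(N,g)$ be a smooth Riemannian manifold with Christoffel symbols $\Gamma^c_{ab}$, let $\pi:TN\to N$ be its tangent bundle with the induced local coordinates $(x^a,y^a)$, and put $\delta y^a=dy^a+\Gamma^a_{bc}(x)y^c\,dx^b$. Let $$G=g_{ab}\,dx^a dx^b+g_{ab}\,\delta y^a\delta y^b$$ be the Sasaki metric on $TN$, let $V$ be the vertical projector of $T(TN)$ (the projector onto $\ker d\pi$ with kernel the horizontal distribution $\{\delta y^a=0\}$) and $H=1-V$. Let $F(x,y)=(g_{ab}(x)y^ay^b)^{1/2}$ and let $\theta_F=\tfrac12\frac{\partial F^2}{\partial y^a}dx^a$ be the Cartan form. Let $\tilde\nabla$ be the Weyl connection of $(TN,G,\theta_F)$, i.e. the unique torsion-free linear connection on $TN$ with $\tilde\nabla G+\theta_F\otimes G=0$. The Vranceanu–Cartan connection of $(N,g)$ is the linear connection on $TN$ given by $$\nabla^*_XY=V\tilde\nabla_{VX}VY+H\tilde\nabla_{HX}HY+V[HX,VY]+H[VX,HY].$$ Then the projection $\pi:(TN,G)\to(N,g)$ is totally geodesic, i.e. for every geodesic $\gamma$ of $(TN,G)$ (affinely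 parametrized and defined on an open interval) the curve $\pi\circ\gamma$ is a geodesic of $(N,g)$ (constant curves being counted as geodesics), if and only if $\nabla^*$ is torsion-free, i.e. $\nabla^*_XY-\nabla^*_YX=[X,Y]$ for all smooth vector fields $X,Y$ on $TN$. -/

import Mathlib

set_option maxSynthPendingDepth 3

open scoped Manifold ContDiff

noncomputable section

namespace SasakiVranceanu

/-- The pull-back `(a, b) ↦ B (A a, A b)` of the bilinear form `B` by the linear map `A`. -/
def pullBilin {V W : Type*} [AddCommGroup V] [Module ℝ V] [TopologicalSpace V]
    [IsTopologicalAddGroup V] [ContinuousConstSMul ℝ V] [AddCommGroup W] [Module ℝ W]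
    [TopologicalSpace W] [IsTopologicalAddGroup W] [ContinuousConstSMul ℝ W]
    (B : W →L[ℝ] W →L[ℝ] ℝ) (A : V →L[ℝ] W) : V →L[ℝ] V →L[ℝ] ℝ :=
  (ContinuousLinearMap.precomp ℝ A) ∘L (B ∘L A)

section General

/-! ### Metrics, geodesics and Weyl connections on a manifold without boundary

`M` is a manifold modelled on the finite-dimensional space `F` (in the theorem the models are
boundaryless).  A metric is a field of bilinear forms `G p : T_pM × T_pM → ℝ`, a one-form is a
field of linear forms `θ p : T_pM → ℝ`. -/

variable {F : Type*} [NormedAddCommGroup F] [NormedSpace ℝ F] {H : Type*} [TopologicalSpace H]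
  {I : ModelWithCorners ℝ F H} {M : Type*} [TopologicalSpace M] [ChartedSpace H M]

/-- The derivative at the coordinate point `u` of the inverse of the chart `φ` at `p`: it sends
the coordinate vector `a` to the tangent vector `a^i ∂/∂x^i` at the point `φ⁻¹ u`. -/
def chartFrame (I : ModelWithCorners ℝ F H) (p : M) (u : F) :
    F →L[ℝ] TangentSpace I ((extChartAt I p).symm u) :=
  mfderiv 𝓘(ℝ, F) I (extChartAt I p).symm u

/-- The coordinates of a tangent vector at `p` in the chart at `p`. -/
def chartCoords (I : ModelWithCorners ℝ F H) (p : M) : TangentSpace I p →L[ℝ] F :=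
  mfderiv I 𝓘(ℝ, F) (extChartAt I p) p

/-- The tangent vector at `p` with given coordinates in the chart at `p`. -/
def ofChartCoords (I : ModelWithCorners ℝ F H) (p : M) : F →L[ℝ] TangentSpace I p :=
  (chartCoords I p).inverse

/-- The matrix `G_ij(u)` of the metric `G` in the chart at `p`, as a bilinear form. -/
def metricInChart (G : ∀ q : M, TangentSpace I q →L[ℝ] TangentSpace I q →L[ℝ] ℝ)
    (p : M) (u : F) : F →L[ℝ] F →L[ℝ] ℝ :=
  pullBilin (G ((extChartAt I p).symm u)) (chartFrame I p u)

/-- The components `θ_i(u)` of the one-form `θ` in the chart at `p`. -/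
def formInChart (θ : ∀ q : M, TangentSpace I q →L[ℝ] ℝ) (p : M) (u : F) : F →L[ℝ] ℝ :=
  (θ ((extChartAt I p).symm u)).comp (chartFrame I p u)

/-- The components `Y^i(u)` of the vector field `Y` in the chart at `p`. -/
def fieldInChart (Y : ∀ q : M, TangentSpace I q) (p : M) (u : F) : F :=
  (chartFrame I p u).inverse (Y ((extChartAt I p).symm u))

/-- Christoffel symbols of the first kind of a metric `h = (h_ij(u))` on (an open part of) `F`:
`(a, b, c) ↦ ½ ((∂_a h)(b, c) + (∂_b h)(a, c) - (∂_c h)(a, b))`. -/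
def christoffelFirst (h : F → F →L[ℝ] F →L[ℝ] ℝ) (u : F) : F →L[ℝ] F →L[ℝ] F →L[ℝ] ℝ :=
  let D : F →L[ℝ] F →L[ℝ] F →L[ℝ] ℝ := fderiv ℝ h u
  let S : (F →L[ℝ] F →L[ℝ] ℝ) →L[ℝ] (F →L[ℝ] F →L[ℝ] ℝ) :=
    ((ContinuousLinearMap.flipₗᵢ ℝ F F ℝ : (F →L[ℝ] F →L[ℝ] ℝ) ≃ₗᵢ[ℝ] (F →L[ℝ] F →L[ℝ] ℝ)) :
      (F →L[ℝ] F →L[ℝ] ℝ) ≃L[ℝ] (F →L[ℝ] F →L[ℝ] ℝ))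
  (1 / 2 : ℝ) • (D + D.flip - S.comp D.flip)

theorem christoffelFirst_apply (h : F → F →L[ℝ] F →L[ℝ] ℝ) (u a b c : F) :
    christoffelFirst h u a b c = (1 / 2 : ℝ) *
      (fderiv ℝ h u a b c + fderiv ℝ h u b a c - fderiv ℝ h u c a b) := by
  simp [christoffelFirst]

/-- The Christoffel symbols `Γ^k_ij a^i b^j` of `G` in the chart at `p`, at the coordinate
point `u`.  Here `(h u).inverse : F* → F` is the inverse matrix `(h^{ij})` raising an index. -/
def christoffel (G : ∀ q : M, TangentSpace I q →L[ℝ] TangentSpace I q →L[ℝ] ℝ)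
    (p : M) (u : F) : F →L[ℝ] F →L[ℝ] F :=
  (ContinuousLinearMap.compL ℝ F (F →L[ℝ] ℝ) F (metricInChart G p u).inverse) ∘L
    christoffelFirst (metricInChart G p) u

/-- `γ` is a geodesic of `G` on the open interval `J`: it is `C²` and at each `t ∈ J` it satisfies
`x''^k + Γ^k_ij x'^i x'^j = 0` in the chart at `γ t`.  (Geodesics are affinely parametrized, and
constant curves are geodesics.) -/
structure IsGeodesicOn (G : ∀ q : M, TangentSpace I q →L[ℝ] TangentSpace I q →L[ℝ] ℝ)
    (γ : ℝ → M) (J : Set ℝ) : Prop where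
  contMDiffOn : ContMDiffOn 𝓘(ℝ, ℝ) I 2 γ J
  equation : ∀ t ∈ J,
    deriv (deriv (fun s => extChartAt I (γ t) (γ s))) t
      + christoffel G (γ t) (extChartAt I (γ t) (γ t))
          (deriv (fun s => extChartAt I (γ t) (γ s)) t)
          (deriv (fun s => extChartAt I (γ t) (γ s)) t) = 0

/-- The symbols `Γ^k_ij + ½ (θ_i δ^k_j + θ_j δ^k_i - G_ij θ^k)`, contracted with `a^i b^j`, of the
Weyl connection of `(G, θ)` at `p` in the chart at `p`. -/
def weylSymbol (G : ∀ q : M, TangentSpace I q →L[ℝ] TangentSpace I q →L[ℝ] ℝ)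
    (θ : ∀ q : M, TangentSpace I q →L[ℝ] ℝ) (p : M) (a b : F) : F :=
  let u := extChartAt I p p
  christoffel G p u a b + (1 / 2 : ℝ) •
    (formInChart θ p u a • b + formInChart θ p u b • a
      - metricInChart G p u a b • (metricInChart G p u).inverse (formInChart θ p u))

/-- The Weyl connection `∇~` of `(G, θ)`, i.e. the torsion-free linear connection with
`∇~ G + θ ⊗ G = 0`: `(∇~_X Y)^k = X^i (∂_i Y^k + Γ~^k_ij Y^j)`. -/
def weylConnection (G : ∀ q : M, TangentSpace I q →L[ℝ] TangentSpace I q →L[ℝ] ℝ)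
    (θ : ∀ q : M, TangentSpace I q →L[ℝ] ℝ) (X Y : ∀ q : M, TangentSpace I q) (p : M) :
    TangentSpace I p :=
  let u := extChartAt I p p
  ofChartCoords I p
    (fderiv ℝ (fieldInChart Y p) u (fieldInChart X p u)
      + weylSymbol G θ p (fieldInChart X p u) (fieldInChart Y p u))

/-- The Vranceanu connection of the Weyl manifold `(M, G, θ)` and of the distribution with
orthogonal projector `Q`, where `Q' = 1 - Q`:
`∇*_X Y = Q ∇~_{QX} QY + Q' ∇~_{Q'X} Q'Y + Q [Q'X, QY] + Q' [QX, Q'Y]`. -/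
def vranceanuConnection (G : ∀ q : M, TangentSpace I q →L[ℝ] TangentSpace I q →L[ℝ] ℝ)
    (θ : ∀ q : M, TangentSpace I q →L[ℝ] ℝ) (Q : ∀ q : M, TangentSpace I q →L[ℝ] TangentSpace I q)
    (X Y : ∀ q : M, TangentSpace I q) (p : M) : TangentSpace I p :=
  let Q' : ∀ q : M, TangentSpace I q →L[ℝ] TangentSpace I q :=
    fun q => ContinuousLinearMap.id ℝ (TangentSpace I q) - Q q
  Q p (weylConnection G θ (fun q => Q q (X q)) (fun q => Q q (Y q)) p)
    + Q' p (weylConnection G θ (fun q => Q' q (X q)) (fun q => Q' q (Y q)) p)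
    + Q p (VectorField.mlieBracket I (fun q => Q' q (X q)) (fun q => Q q (Y q)) p)
    + Q' p (VectorField.mlieBracket I (fun q => Q q (X q)) (fun q => Q' q (Y q)) p)

/-- `∇_X Y - ∇_Y X = [X, Y]` for all smooth vector fields `X`, `Y`. -/
def IsTorsionFree [IsManifold I 1 M]
    (D : (∀ q : M, TangentSpace I q) → (∀ q : M, TangentSpace I q) → ∀ q : M, TangentSpace I q) :
    Prop :=
  ∀ X Y : ∀ q : M, TangentSpace I q,
    ContMDiff I I.tangent ∞ (fun q => (⟨q, X q⟩ : TangentBundle I M)) →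
    ContMDiff I I.tangent ∞ (fun q => (⟨q, Y q⟩ : TangentBundle I M)) →
    ∀ p : M, D X Y p - D Y X p = VectorField.mlieBracket I X Y p

end General

section TangentBundle

/-! ### The tangent bundle of a Riemannian manifold `(N, g)` -/

variable {E : Type*} [NormedAddCommGroup E] [NormedSpace ℝ E]
  {N : Type*} [TopologicalSpace N] [ChartedSpace E N] [IsManifold 𝓘(ℝ, E) ∞ N]

/-- Smooth Riemannian metrics on `N`. -/
abbrev RiemMetric (E : Type*) [NormedAddCommGroup E] [NormedSpace ℝ E]
    (N : Type*) [TopologicalSpace N] [ChartedSpace E N] [IsManifold 𝓘(ℝ, E) ∞ N] :=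
  Bundle.ContMDiffRiemannianMetric 𝓘(ℝ, E) ∞ E (fun x : N => TangentSpace 𝓘(ℝ, E) x)

/-- The coordinates `(x, y)` of `v` in the chart of `TN` induced by the chart of `N` at the base
point of `v`. -/
def xyCoords (v : TangentBundle 𝓘(ℝ, E) N) : E × E := extChartAt 𝓘(ℝ, E).tangent v v

/-- The coordinate one-forms `dx^a` on `TN`, at `v`, for the induced coordinates `(x, y)`. -/
def dx (v : TangentBundle 𝓘(ℝ, E) N) : TangentSpace 𝓘(ℝ, E).tangent v →L[ℝ] E :=
  (ContinuousLinearMap.fst ℝ E E) ∘L chartCoords 𝓘(ℝ, E).tangent v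

/-- The coordinate one-forms `dy^a` on `TN`, at `v`, for the induced coordinates `(x, y)`. -/
def dy (v : TangentBundle 𝓘(ℝ, E) N) : TangentSpace 𝓘(ℝ, E).tangent v →L[ℝ] E :=
  (ContinuousLinearMap.snd ℝ E E) ∘L chartCoords 𝓘(ℝ, E).tangent v

/-- The coefficients `G^a_b(x, y) = Γ^a_bc(x) y^c` of the horizontal distribution, as the linear
map `w ↦ G^a_b w^b`. -/
def nonlinearConnection (g : RiemMetric E N) (v : TangentBundle 𝓘(ℝ, E) N) : E →L[ℝ] E :=
  (christoffel g.inner v.proj (xyCoords v).1).flip (xyCoords v).2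

/-- The one-forms `δy^a = dy^a + G^a_b dx^b` at `v`; their common kernel is the horizontal
space, spanned by `δ/δx^a = ∂/∂x^a - G^b_a ∂/∂y^b`. -/
def deltaY (g : RiemMetric E N) (v : TangentBundle 𝓘(ℝ, E) N) :
    TangentSpace 𝓘(ℝ, E).tangent v →L[ℝ] E :=
  dy v + nonlinearConnection g v ∘L dx v

/-- The Sasaki metric `G = g_ab dx^a dx^b + g_ab δy^a δy^b` on `TN`. -/
def sasakiMetric (g : RiemMetric E N) (v : TangentBundle 𝓘(ℝ, E) N) :
    TangentSpace 𝓘(ℝ, E).tangent v →L[ℝ] TangentSpace 𝓘(ℝ, E).tangent v →L[ℝ] ℝ :=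
  pullBilin (metricInChart g.inner v.proj (xyCoords v).1) (dx v)
    + pullBilin (metricInChart g.inner v.proj (xyCoords v).1) (deltaY g v)

/-- The vertical projector `δy^a ⊗ ∂/∂y^a` of `T(TN)`, with kernel the horizontal distribution. -/
def verticalProjector (g : RiemMetric E N) (v : TangentBundle 𝓘(ℝ, E) N) :
    TangentSpace 𝓘(ℝ, E).tangent v →L[ℝ] TangentSpace 𝓘(ℝ, E).tangent v :=
  ofChartCoords 𝓘(ℝ, E).tangent v ∘L (ContinuousLinearMap.inr ℝ E E) ∘L deltaY g v

/-- The fundamental function `F(x, y) = (g_ab(x) y^a y^b)^{1/2}`. -/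
def fundamentalFunction (g : RiemMetric E N) (v : TangentBundle 𝓘(ℝ, E) N) : ℝ :=
  Real.sqrt (g.inner v.proj v.2 v.2)

/-- The Cartan form `θ_F = ½ (∂F²/∂y^a) dx^a` on `TN`. -/
def cartanForm (g : RiemMetric E N) (v : TangentBundle 𝓘(ℝ, E) N) :
    TangentSpace 𝓘(ℝ, E).tangent v →L[ℝ] ℝ :=
  (1 / 2 : ℝ) • (fderiv ℝ (fun y : E => fundamentalFunction g
    ((extChartAt 𝓘(ℝ, E).tangent v).symm ((xyCoords v).1, y)) ^ 2) (xyCoords v).2) ∘L dx v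

/-- The Vranceanu–Cartan connection of `(N, g)`: the Vranceanu connection on `TN` of the Sasaki
metric `G`, the one-form `W(G) = θ_F` and the vertical distribution. -/
def vranceanuCartan (g : RiemMetric E N)
    (X Y : ∀ v : TangentBundle 𝓘(ℝ, E) N, TangentSpace 𝓘(ℝ, E).tangent v)
    (v : TangentBundle 𝓘(ℝ, E) N) : TangentSpace 𝓘(ℝ, E).tangent v :=
  vranceanuConnection (sasakiMetric g) (cartanForm g) (verticalProjector g) X Y v

/-- The projection `π : (TN, G) → (N, g)` is totally geodesic: it maps each geodesic of `G`,
defined on any open interval, to a geodesic of `g`. -/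
def ProjectionTotallyGeodesic (g : RiemMetric E N) : Prop :=
  ∀ (J : Set ℝ) (γ : ℝ → TangentBundle 𝓘(ℝ, E) N), IsOpen J → J.OrdConnected →
    IsGeodesicOn (sasakiMetric g) γ J → IsGeodesicOn g.inner (fun t => (γ t).proj) J

end TangentBundle

end SasakiVranceanu

end

noncomputable section

namespace SasakiVranceanu

open Filter Topology

/-! ### Christoffel symbols on a vector space and their transformation law. -/

section Calculus

variable {F : Type*} [NormedAddCommGroup F] [NormedSpace ℝ F]
  {F' : Type*} [NormedAddCommGroup F'] [NormedSpace ℝ F']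

/-! Both properties are equivalent to the vanishing of the curvature R of the horizontal
distribution, where V[HX,HY] = -R(HX,HY).

Torsion: the Weyl connection is torsion-free for every choice of one-form, so antisymmetrizing ∇*
replaces its two Weyl terms by V[VX,VY] and H[HX,HY], while the mixed terms add up to [VX,HY] +
[HX,VY]. Since the vertical distribution is involutive, subtracting [X,Y] leaves exactly -V[HX,HY] =
R (`torsion_vranceanuCartan`). R is tensorial and every vector extends to a smooth field, which
gives `isTorsionFree_iff`.

Geodesics: pairing the geodesic equation of the Sasaki metric with the horizontal lift of c gives
g(x'' + Γ(x',x'), c) + g(δy, R(x',c)) = 0, with δy evaluated on the velocity (`sasakiForm_geodesic`,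
`projection_geodesic_equation`). If R = 0, the projection is a geodesic. Conversely, start a
geodesic with x' = a and δy = R(a,c): if it projects to a geodesic, then |R(a,c)|² = 0. This is
`projectionTotallyGeodesic_iff`. -/

@[simp] theorem pullBilin_apply (B : F' →L[ℝ] F' →L[ℝ] ℝ) (A : F →L[ℝ] F') (a b : F) :
    pullBilin B A a b = B (A a) (A b) := rfl

/-- A basis identifies F with ℝⁿ, hence the linear maps from F to G with Gⁿ, where smoothness is
componentwise. -/
theorem contDiffAt_clm_apply_iff [FiniteDimensional ℝ F] {X G : Type*} [NormedAddCommGroup X]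
    [NormedSpace ℝ X] [NormedAddCommGroup G] [NormedSpace ℝ G] {n : ℕ∞ω} {x : X}
    {f : X → F →L[ℝ] G} : ContDiffAt ℝ n f x ↔ ∀ a, ContDiffAt ℝ n (fun u => f u a) x := by
  refine ⟨fun h y => h.clm_apply contDiffAt_const, fun h => ?_⟩
  have hd : Module.finrank ℝ F = Module.finrank ℝ (Fin (Module.finrank ℝ F) → ℝ) :=
    (Module.finrank_fin_fun ℝ).symm
  let e₁ := ContinuousLinearEquiv.ofFinrankEq hd
  let e₂ := (e₁.arrowCongr (1 : G ≃L[ℝ] G)).trans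
    (ContinuousLinearEquiv.piRing (Fin (Module.finrank ℝ F)))
  rw [← Function.id_comp f, ← e₂.symm_comp_self]
  exact e₂.symm.contDiff.contDiffAt.comp x (contDiffAt_pi.mpr fun i => h _)

theorem _root_.ContDiffAt.pullBilin [FiniteDimensional ℝ F] {X : Type*} [NormedAddCommGroup X]
    [NormedSpace ℝ X] {n : ℕ∞ω} {x : X} {B : X → F' →L[ℝ] F' →L[ℝ] ℝ} {A : X → F →L[ℝ] F'}
    (hB : ContDiffAt ℝ n B x) (hA : ContDiffAt ℝ n A x) :
    ContDiffAt ℝ n (fun u => SasakiVranceanu.pullBilin (B u) (A u)) x := by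
  simp only [contDiffAt_clm_apply_iff]
  intro a b
  exact (hB.clm_apply (hA.clm_apply contDiffAt_const)).clm_apply
    (hA.clm_apply contDiffAt_const)

/-- A positive definite bilinear form on a finite-dimensional space is nondegenerate. -/
theorem isInvertible_of_pos [FiniteDimensional ℝ F] (B : F →L[ℝ] F →L[ℝ] ℝ)
    (hB : ∀ a, a ≠ 0 → 0 < B a a) : B.IsInvertible := by
  have hinj : Function.Injective (B : F →ₗ[ℝ] F →L[ℝ] ℝ) := by
    rw [injective_iff_map_eq_zero]
    intro a ha
    by_contra h
    have h1 := hB a h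
    have h2 : B a = 0 := ha
    simp [h2] at h1
  have hdim : Module.finrank ℝ F = Module.finrank ℝ (F →L[ℝ] ℝ) := by
    rw [← (LinearMap.toContinuousLinearMap (𝕜 := ℝ) (E := F) (F' := ℝ)).finrank_eq]
    exact (Subspace.dual_finrank_eq).symm
  refine ⟨(LinearEquiv.ofInjectiveOfFinrankEq _ hinj hdim).toContinuousLinearEquiv, ?_⟩
  ext a b
  rfl

theorem fderiv_apply_apply {h : F → F' →L[ℝ] F' →L[ℝ] ℝ} {u : F} (hh : DifferentiableAt ℝ h u)
    (w : F) (a b : F') : fderiv ℝ h u w a b = fderiv ℝ (fun v => h v a b) u w := by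
  have h1 : HasFDerivAt (fun v => h v a b) _ u :=
    (hh.hasFDerivAt.clm_apply (hasFDerivAt_const a u)).clm_apply (hasFDerivAt_const b u)
  rw [h1.fderiv]
  simp

theorem fderiv_symm {h : F → F' →L[ℝ] F' →L[ℝ] ℝ} {u : F} (hh : DifferentiableAt ℝ h u)
    (hs : ∀ᶠ v in 𝓝 u, ∀ a b, h v a b = h v b a) (w : F) (a b : F') :
    fderiv ℝ h u w a b = fderiv ℝ h u w b a := by
  rw [fderiv_apply_apply hh, fderiv_apply_apply hh]
  congr 1
  exact EventuallyEq.fderiv_eq (hs.mono fun v hv => hv a b)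

theorem christoffelFirst_symm {h : F → F →L[ℝ] F →L[ℝ] ℝ} {u : F} (hh : DifferentiableAt ℝ h u)
    (hs : ∀ᶠ v in 𝓝 u, ∀ a b, h v a b = h v b a) (a b c : F) :
    christoffelFirst h u a b c = christoffelFirst h u b a c := by
  rw [christoffelFirst_apply, christoffelFirst_apply, fderiv_symm hh hs c a b]
  ring

/-- The product rule applied to k(ψ)(Dψ a, Dψ b) yields the pulled-back symbols plus
second-derivative terms. This is the source of the inhomogeneous term in the transformation law. -/
theorem christoffelFirst_pullback {h : F → F →L[ℝ] F →L[ℝ] ℝ} {k : F' → F' →L[ℝ] F' →L[ℝ] ℝ}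
    {ψ : F → F'} {u : F} (hk : DifferentiableAt ℝ k (ψ u))
    (hs : ∀ᶠ v in 𝓝 (ψ u), ∀ a b, k v a b = k v b a) (hψ : ContDiffAt ℝ 2 ψ u)
    (hh : DifferentiableAt ℝ h u)
    (he : ∀ᶠ v in 𝓝 u, h v = pullBilin (k (ψ v)) (fderiv ℝ ψ v)) (a b c : F) :
    christoffelFirst h u a b c =
      christoffelFirst k (ψ u) (fderiv ℝ ψ u a) (fderiv ℝ ψ u b) (fderiv ℝ ψ u c)
        + k (ψ u) (fderiv ℝ (fderiv ℝ ψ) u a b) (fderiv ℝ ψ u c) := by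
  have hD : DifferentiableAt ℝ (fderiv ℝ ψ) u :=
    (hψ.fderiv_right (m := 1) (by norm_num)).differentiableAt (by norm_num)
  have hψ1 : DifferentiableAt ℝ ψ u := hψ.differentiableAt (by norm_num)
  have key : ∀ w a b : F, fderiv ℝ h u w a b =
      fderiv ℝ k (ψ u) (fderiv ℝ ψ u w) (fderiv ℝ ψ u a) (fderiv ℝ ψ u b)
      + k (ψ u) (fderiv ℝ (fderiv ℝ ψ) u w a) (fderiv ℝ ψ u b)
      + k (ψ u) (fderiv ℝ ψ u a) (fderiv ℝ (fderiv ℝ ψ) u w b) := by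
    intro w a b
    rw [fderiv_apply_apply hh]
    have e : (fun v => h v a b) =ᶠ[𝓝 u] fun v => k (ψ v) (fderiv ℝ ψ v a) (fderiv ℝ ψ v b) :=
      he.mono fun v hv => by simp only [hv, pullBilin_apply]
    rw [e.fderiv_eq]
    have h1 : HasFDerivAt (fun v => k (ψ v) (fderiv ℝ ψ v a) (fderiv ℝ ψ v b)) _ u :=
      (((hk.hasFDerivAt.comp u hψ1.hasFDerivAt).clm_apply
        (hD.hasFDerivAt.clm_apply (hasFDerivAt_const a u)))).clm_apply
        (hD.hasFDerivAt.clm_apply (hasFDerivAt_const b u))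
    rw [h1.fderiv]
    simp
    ring
  -- By symmetry of D²ψ and of k, four of the six second-derivative terms cancel and the other two
  -- are equal, absorbing the factor 1/2.
  have sym : ∀ v w, fderiv ℝ (fderiv ℝ ψ) u v w = fderiv ℝ (fderiv ℝ ψ) u w v :=
    hψ.isSymmSndFDerivAt (by simp)
  have ks := hs.self_of_nhds
  rw [christoffelFirst_apply, christoffelFirst_apply, key, key, key, sym c a, sym c b, sym b a,
    ks (fderiv ℝ ψ u b), ks (fderiv ℝ ψ u a) (fderiv ℝ (fderiv ℝ ψ) u b c)]
  ring

/-- The Christoffel symbols of the metric `h` on (an open part of) a vector space. -/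
def christoffelSymbol (h : F → F →L[ℝ] F →L[ℝ] ℝ) (u : F) : F →L[ℝ] F →L[ℝ] F :=
  (ContinuousLinearMap.compL ℝ F (F →L[ℝ] ℝ) F (h u).inverse) ∘L christoffelFirst h u

theorem apply_christoffelSymbol {h : F → F →L[ℝ] F →L[ℝ] ℝ} {u : F} (hi : (h u).IsInvertible)
    (a b c : F) : h u (christoffelSymbol h u a b) c = christoffelFirst h u a b c := by
  obtain ⟨e, he⟩ := hi
  simp [christoffelSymbol, ← he]

theorem christoffelSymbol_symm {h : F → F →L[ℝ] F →L[ℝ] ℝ} {u : F} (hh : DifferentiableAt ℝ h u)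
    (hs : ∀ᶠ v in 𝓝 u, ∀ a b, h v a b = h v b a) (a b : F) :
    christoffelSymbol h u a b = christoffelSymbol h u b a := by
  have : christoffelFirst h u a b = christoffelFirst h u b a := by
    ext c
    exact christoffelFirst_symm hh hs a b c
  simp [christoffelSymbol, this]

/-- Lower the index with k and test on vectors of the form Dψ d, which exhaust the target since Dψ
is invertible; this reduces the claim to `christoffelFirst_pullback`. -/
theorem christoffelSymbol_pullback {h : F → F →L[ℝ] F →L[ℝ] ℝ} {k : F' → F' →L[ℝ] F' →L[ℝ] ℝ}
    {ψ : F → F'} {u : F} (hk : DifferentiableAt ℝ k (ψ u))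
    (hs : ∀ᶠ v in 𝓝 (ψ u), ∀ a b, k v a b = k v b a) (hψ : ContDiffAt ℝ 2 ψ u)
    (hh : DifferentiableAt ℝ h u)
    (he : ∀ᶠ v in 𝓝 u, h v = pullBilin (k (ψ v)) (fderiv ℝ ψ v))
    (hki : (k (ψ u)).IsInvertible) (hhi : (h u).IsInvertible) (hψi : (fderiv ℝ ψ u).IsInvertible)
    (a b : F) :
    fderiv ℝ ψ u (christoffelSymbol h u a b) =
      christoffelSymbol k (ψ u) (fderiv ℝ ψ u a) (fderiv ℝ ψ u b)
        + fderiv ℝ (fderiv ℝ ψ) u a b := by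
  obtain ⟨e, he'⟩ := hki
  obtain ⟨f, hf⟩ := hψi
  apply e.injective
  ext c
  obtain ⟨d, rfl⟩ := f.surjective c
  have h1 := christoffelFirst_pullback hk hs hψ hh he a b d
  rw [← apply_christoffelSymbol hhi, ← apply_christoffelSymbol ⟨e, he'⟩, he.self_of_nhds,
    pullBilin_apply, ← he', ← hf] at h1
  simpa [← hf] using h1

theorem _root_.ContDiffAt.christoffelFirst [FiniteDimensional ℝ F] {n : ℕ∞ω}
    {h : F → F →L[ℝ] F →L[ℝ] ℝ} {u : F} (hh : ContDiffAt ℝ (n + 1) h u) :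
    ContDiffAt ℝ n (SasakiVranceanu.christoffelFirst h) u := by
  have hD : ContDiffAt ℝ n (fderiv ℝ h) u := hh.fderiv_right le_rfl
  simp only [contDiffAt_clm_apply_iff, christoffelFirst_apply]
  intro a b c
  have key : ∀ a b c : F, ContDiffAt ℝ n (fun u => fderiv ℝ h u a b c) u :=
    fun a b c => ((hD.clm_apply contDiffAt_const).clm_apply contDiffAt_const).clm_apply
      contDiffAt_const
  exact contDiffAt_const.mul (((key a b c).add (key b a c)).sub (key c a b))

/-- One derivative is spent on the symbols of the first kind; raising the index is harmless because
inversion is smooth at an invertible map. -/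
theorem _root_.ContDiffAt.christoffelSymbol [FiniteDimensional ℝ F] {n : ℕ∞ω}
    {h : F → F →L[ℝ] F →L[ℝ] ℝ} {u : F} (hh : ContDiffAt ℝ (n + 1) h u)
    (hi : (h u).IsInvertible) :
    ContDiffAt ℝ n (SasakiVranceanu.christoffelSymbol h) u := by
  have : CompleteSpace F := FiniteDimensional.complete ℝ F
  have h1 : ContDiffAt ℝ n (fun v => (h v).inverse) u := by
    obtain ⟨e, he⟩ := hi
    refine ContDiffAt.comp u (g := ContinuousLinearMap.inverse) ?_
      (hh.of_le (by exact self_le_add_right n 1))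
    rw [← he]
    exact contDiffAt_map_inverse e
  have h2 : ContDiffAt ℝ n (SasakiVranceanu.christoffelFirst h) u := hh.christoffelFirst
  exact ((ContinuousLinearMap.compL ℝ F (F →L[ℝ] ℝ) F).contDiff.contDiffAt.comp u h1).clm_comp h2

end Calculus
-- The Sasaki metric in coordinates and the horizontal part of its geodesic equation.
section SasakiCalculus

variable {E : Type*} [NormedAddCommGroup E] [NormedSpace ℝ E]

/-- The coefficients `Γ^a_bc(x) y^c` at `u = (x, y)`, as a linear map in the index `b`. -/
def connectionCoeff (Γ : E → E →L[ℝ] E →L[ℝ] E) (u : E × E) : E →L[ℝ] E := (Γ u.1).flip u.2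

/-- The linear form `δy = dy + Γ y dx` at `u = (x, y)`. -/
def deltaForm (Γ : E → E →L[ℝ] E →L[ℝ] E) (u : E × E) : E × E →L[ℝ] E :=
  ContinuousLinearMap.snd ℝ E E + connectionCoeff Γ u ∘L ContinuousLinearMap.fst ℝ E E

/-- The Sasaki metric of `h` and of the connection `Γ`, in coordinates. -/
def sasakiForm (h : E → E →L[ℝ] E →L[ℝ] ℝ) (Γ : E → E →L[ℝ] E →L[ℝ] E) (u : E × E) :
    E × E →L[ℝ] E × E →L[ℝ] ℝ :=
  pullBilin (h u.1) (ContinuousLinearMap.fst ℝ E E) + pullBilin (h u.1) (deltaForm Γ u)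

/-- The horizontal lift of `a` at `u`, in coordinates. -/
def horizontalLift (Γ : E → E →L[ℝ] E →L[ℝ] E) (u : E × E) (a : E) : E × E :=
  (a, -connectionCoeff Γ u a)

/-- The curvature of the horizontal distribution `ker δy`, in coordinates. -/
def horizontalCurvature (Γ : E → E →L[ℝ] E →L[ℝ] E) (u : E × E) (a c : E) : E :=
  fderiv ℝ (connectionCoeff Γ) u (horizontalLift Γ u a) c
    - fderiv ℝ (connectionCoeff Γ) u (horizontalLift Γ u c) a

@[simp] theorem deltaForm_apply (Γ : E → E →L[ℝ] E →L[ℝ] E) (u w : E × E) :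
    deltaForm Γ u w = w.2 + connectionCoeff Γ u w.1 := rfl

@[simp] theorem sasakiForm_apply (h : E → E →L[ℝ] E →L[ℝ] ℝ) (Γ : E → E →L[ℝ] E →L[ℝ] E)
    (u a b : E × E) : sasakiForm h Γ u a b =
      h u.1 a.1 b.1 + h u.1 (a.2 + connectionCoeff Γ u a.1) (b.2 + connectionCoeff Γ u b.1) := rfl

theorem hasFDerivAt_connectionCoeff {Γ : E → E →L[ℝ] E →L[ℝ] E} {u : E × E}
    (hΓ : DifferentiableAt ℝ Γ u.1) (a : E) :
    HasFDerivAt (fun v => connectionCoeff Γ v a)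
      ((Γ u.1 a) ∘L (ContinuousLinearMap.snd ℝ E E) +
        ((fderiv ℝ Γ u.1).flip a).flip u.2 ∘L ContinuousLinearMap.fst ℝ E E) u := by
  have h1 : HasFDerivAt (fun v : E × E => Γ v.1) _ u := hΓ.hasFDerivAt.comp u hasFDerivAt_fst
  have h2 : HasFDerivAt (fun v : E × E => connectionCoeff Γ v a) _ u :=
    (h1.clm_apply (hasFDerivAt_const a u)).clm_apply hasFDerivAt_snd
  exact h2.congr_fderiv (ContinuousLinearMap.ext fun w => by simp)

variable [FiniteDimensional ℝ E]

theorem _root_.ContDiffAt.connectionCoeff {Γ : E → E →L[ℝ] E →L[ℝ] E} {u : E × E} {n : ℕ∞ω}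
    (hΓ : ContDiffAt ℝ n Γ u.1) : ContDiffAt ℝ n (SasakiVranceanu.connectionCoeff Γ) u := by
  rw [contDiffAt_clm_apply_iff]
  intro a
  exact ((hΓ.comp u contDiffAt_fst).clm_apply contDiffAt_const).clm_apply contDiffAt_snd

theorem _root_.ContDiffAt.deltaForm {Γ : E → E →L[ℝ] E →L[ℝ] E} {u : E × E} {n : ℕ∞ω}
    (hΓ : ContDiffAt ℝ n Γ u.1) : ContDiffAt ℝ n (SasakiVranceanu.deltaForm Γ) u :=
  contDiffAt_const.add (hΓ.connectionCoeff.clm_comp contDiffAt_const)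

theorem _root_.ContDiffAt.sasakiForm {h : E → E →L[ℝ] E →L[ℝ] ℝ} {Γ : E → E →L[ℝ] E →L[ℝ] E}
    {u : E × E} {n : ℕ∞ω} (hh : ContDiffAt ℝ n h u.1) (hΓ : ContDiffAt ℝ n Γ u.1) :
    ContDiffAt ℝ n (SasakiVranceanu.sasakiForm h Γ) u :=
  ((hh.comp u contDiffAt_fst).pullBilin contDiffAt_const).add
    ((hh.comp u contDiffAt_fst).pullBilin hΓ.deltaForm)

/-- The coefficients Γ(x)y are linear in y, so their vertical derivative is Γ itself. -/
theorem fderiv_connectionCoeff_vertical {Γ : E → E →L[ℝ] E →L[ℝ] E} {u : E × E}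
    (hΓ : ContDiffAt ℝ 1 Γ u.1) (d a : E) :
    fderiv ℝ (connectionCoeff Γ) u (0, d) a = Γ u.1 a d := by
  have hN : DifferentiableAt ℝ (connectionCoeff Γ) u :=
    hΓ.connectionCoeff.differentiableAt one_ne_zero
  have h1 := (hN.hasFDerivAt.clm_apply (hasFDerivAt_const a u)).unique
    (hasFDerivAt_connectionCoeff (hΓ.differentiableAt one_ne_zero) a)
  have h2 := congrArg (fun L => L (0, d)) h1
  simpa using h2

/-- The derivative of `connectionCoeff` is left unexpanded so that `horizontalCurvature` can be
recognized later. -/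
theorem fderiv_sasakiForm {h : E → E →L[ℝ] E →L[ℝ] ℝ} {Γ : E → E →L[ℝ] E →L[ℝ] E} {u : E × E}
    (hh : ContDiffAt ℝ 1 h u.1) (hΓ : ContDiffAt ℝ 1 Γ u.1) (w a b : E × E) :
    fderiv ℝ (sasakiForm h Γ) u w a b =
      fderiv ℝ h u.1 w.1 a.1 b.1
      + fderiv ℝ h u.1 w.1 (deltaForm Γ u a) (deltaForm Γ u b)
      + h u.1 (fderiv ℝ (connectionCoeff Γ) u w a.1) (deltaForm Γ u b)
      + h u.1 (deltaForm Γ u a) (fderiv ℝ (connectionCoeff Γ) u w b.1) := by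
  have hN : DifferentiableAt ℝ (connectionCoeff Γ) u :=
    hΓ.connectionCoeff.differentiableAt one_ne_zero
  rw [fderiv_apply_apply ((hh.sasakiForm hΓ).differentiableAt one_ne_zero)]
  simp only [sasakiForm_apply, deltaForm_apply]
  have k : HasFDerivAt (fun v : E × E => h v.1) _ u :=
    (hh.differentiableAt one_ne_zero).hasFDerivAt.comp u hasFDerivAt_fst
  have d : ∀ a : E × E, HasFDerivAt (fun v => a.2 + connectionCoeff Γ v a.1) _ u := fun a =>
    (hN.hasFDerivAt.clm_apply (hasFDerivAt_const a.1 u)).const_add a.2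
  have s : HasFDerivAt (fun v : E × E => h v.1 a.1 b.1 +
      h v.1 (a.2 + connectionCoeff Γ v a.1) (b.2 + connectionCoeff Γ v b.1)) _ u :=
    ((k.clm_apply (hasFDerivAt_const a.1 u)).clm_apply (hasFDerivAt_const b.1 u)).add
      ((k.clm_apply (d a)).clm_apply (d b))
  rw [s.fderiv]
  simp
  abel

/-- Positive definiteness suffices: dx and δy together determine a vector. -/
theorem sasakiForm_isInvertible {h : E → E →L[ℝ] E →L[ℝ] ℝ} {Γ : E → E →L[ℝ] E →L[ℝ] E}
    {u : E × E} (hp : ∀ a, a ≠ 0 → 0 < h u.1 a a) : (sasakiForm h Γ u).IsInvertible := by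
  refine isInvertible_of_pos _ fun w hw => ?_
  have hp' : ∀ a, 0 ≤ h u.1 a a := fun a => by
    rcases eq_or_ne a 0 with rfl | ha
    · simp
    · exact (hp a ha).le
  rw [sasakiForm_apply]
  rcases eq_or_ne w.1 0 with h0 | h0
  · have h2 : w.2 ≠ 0 := fun h2 => hw (Prod.ext h0 h2)
    have := hp _ h2
    simpa [h0] using this
  · exact add_pos_of_pos_of_nonneg (hp _ h0) (hp' _)

/-- The horizontal part of the geodesic equation of the Sasaki metric. -/
theorem sasakiForm_geodesic {h : E → E →L[ℝ] E →L[ℝ] ℝ} {u : E × E}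
    (hh : ContDiffAt ℝ 2 h u.1) (hs : ∀ᶠ v in 𝓝 u.1, ∀ a b, h v a b = h v b a)
    (hp : ∀ a, a ≠ 0 → 0 < h u.1 a a) (w z : E × E)
    (hz : z + christoffelSymbol (sasakiForm h (christoffelSymbol h)) u w w = 0) (c : E) :
    h u.1 (z.1 + christoffelSymbol h u.1 w.1 w.1) c
      + h u.1 (deltaForm (christoffelSymbol h) u w)
          (horizontalCurvature (christoffelSymbol h) u w.1 c) = 0 := by
  have hi : (h u.1).IsInvertible := isInvertible_of_pos _ hp
  have hh1 : ContDiffAt ℝ 1 h u.1 := hh.of_le (by norm_num)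
  have hd : DifferentiableAt ℝ h u.1 := hh1.differentiableAt one_ne_zero
  have hΓ : ContDiffAt ℝ 1 (christoffelSymbol h) u.1 :=
    ContDiffAt.christoffelSymbol (n := 1) (hh.of_le (by norm_num)) hi
  have hS := sasakiForm_isInvertible (Γ := christoffelSymbol h) hp
  have sy := hs.self_of_nhds
  set Γ := christoffelSymbol h with hΓdef
  set δ := deltaForm Γ u w with hδ
  -- Testing against a horizontal vector removes every term in which δy is evaluated on C.
  set C := horizontalLift Γ u c with hC
  have hδC : deltaForm Γ u C = 0 := by simp [hC, horizontalLift]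
  have hC1 : C.1 = c := rfl
  have hw : w = horizontalLift Γ u w.1 + (0, δ) := by
    ext <;> simp [horizontalLift, hδ]
  have h1 := apply_christoffelSymbol hS w w C
  have h2 : sasakiForm h Γ u z C + christoffelFirst (sasakiForm h Γ) u w w C = 0 := by
    rw [← h1, ← add_apply, ← map_add, hz]
    simp
  -- Split w into horizontal and vertical parts: the former supplies the curvature, the latter a
  -- term in Γ.
  have h3 : fderiv ℝ (connectionCoeff Γ) u w c =
      fderiv ℝ (connectionCoeff Γ) u (horizontalLift Γ u w.1) c + Γ u.1 c δ := by
    conv_lhs => rw [hw, map_add, add_apply,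
      fderiv_connectionCoeff_vertical hΓ]
  -- Metric compatibility of Γ: this cancels the vertical term of `h3` against the derivative of
  -- g(δy, δy) along C.
  have h4 : h u.1 (Γ u.1 c δ) δ = 1 / 2 * fderiv ℝ h u.1 c δ δ := by
    rw [hΓdef, apply_christoffelSymbol hi, christoffelFirst_apply]
    ring
  have h5 : h u.1 (Γ u.1 w.1 w.1) c = _ := apply_christoffelSymbol hi w.1 w.1 c
  have h6 : sasakiForm h Γ u z C = h u.1 z.1 c := by
    have : sasakiForm h Γ u z C = h u.1 z.1 C.1 + h u.1 (deltaForm Γ u z) (deltaForm Γ u C) := rfl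
    rw [this, hδC, hC1]; simp
  rw [christoffelFirst_apply, fderiv_sasakiForm hh1 hΓ, fderiv_sasakiForm hh1 hΓ,
    hδC, hC1, ← hδ, h3, h6] at h2
  rw [christoffelFirst_apply] at h5
  rw [map_add, add_apply, h5, horizontalCurvature, ← hC]
  simp only [map_add, map_sub, map_zero] at h2 ⊢
  rw [sy δ (Γ u.1 c δ), h4] at h2
  rw [sy (fderiv ℝ (connectionCoeff Γ) u C w.1) δ] at h2
  linear_combination h2

end SasakiCalculus

/-! ### Change of charts for metrics, Christoffel symbols, brackets and Weyl connections. -/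

section Charts

variable {F : Type*} [NormedAddCommGroup F] [NormedSpace ℝ F] {H : Type*} [TopologicalSpace H]
  {I : ModelWithCorners ℝ F H} {M : Type*} [TopologicalSpace M] [ChartedSpace H M]

theorem metricInChart_apply (G : ∀ q : M, TangentSpace I q →L[ℝ] TangentSpace I q →L[ℝ] ℝ)
    (p : M) (u a b : F) : metricInChart G p u a b =
      G ((extChartAt I p).symm u) (chartFrame I p u a) (chartFrame I p u b) := rfl

theorem christoffel_eq (G : ∀ q : M, TangentSpace I q →L[ℝ] TangentSpace I q →L[ℝ] ℝ)
    (p : M) (u : F) : christoffel G p u = christoffelSymbol (metricInChart G p) u := rfl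

/-- The change of coordinates from the chart at `p` to the chart at `q`. -/
def transition (I : ModelWithCorners ℝ F H) (p q : M) : F → F :=
  extChartAt I q ∘ (extChartAt I p).symm

theorem transition_apply (p q : M) (u : F) :
    transition I p q u = extChartAt I q ((extChartAt I p).symm u) := rfl

theorem inverse_apply_of_eq_id {L : F →L[ℝ] F} (h : L = ContinuousLinearMap.id ℝ F) (a : F) :
    L.inverse a = a := by
  rw [h, ContinuousLinearMap.inverse_id, ContinuousLinearMap.id_apply]

theorem continuousAt_symm {p : M} {u : F} (hu : u ∈ (extChartAt I p).target) :
    ContinuousAt (extChartAt I p).symm u := continuousAt_extChartAt_symm'' hu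

theorem eventually_symm_mem_source {p q : M} {u : F} (hu : u ∈ (extChartAt I p).target)
    (hq : (extChartAt I p).symm u ∈ (extChartAt I q).source) :
    ∀ᶠ v in 𝓝 u, (extChartAt I p).symm v ∈ (extChartAt I q).source :=
  (continuousAt_symm hu).preimage_mem_nhds ((isOpen_extChartAt_source q).mem_nhds hq)

theorem isManifold_one [IsManifold I ∞ M] : IsManifold I 1 M :=
  IsManifold.of_le (n := ∞) (by simp)

/-- The tangent space at p is modelled on F through the preferred chart at p, so this chart has
identity derivative at its centre. -/
theorem chartCoords_apply [IsManifold I ∞ M] (p : M) (a : F) : (chartCoords I p a : F) = a := by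
  have : IsManifold I 1 M := isManifold_one
  exact congrArg (fun L : F →L[ℝ] F => L a) (mfderiv_extChartAt_self (I := I) (x := p))

theorem ofChartCoords_apply [IsManifold I ∞ M] (p : M) (a : F) : (ofChartCoords I p a : F) = a := by
  have : IsManifold I 1 M := isManifold_one
  exact inverse_apply_of_eq_id (F := F) (mfderiv_extChartAt_self (I := I) (x := p)) a

variable [I.Boundaryless]

theorem contDiffAt_transition [IsManifold I ∞ M] {p q : M} {u : F}
    (hu : u ∈ (extChartAt I p).target) (hq : (extChartAt I p).symm u ∈ (extChartAt I q).source) :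
    ContDiffAt ℝ ∞ (transition I p q) u := by
  have h := contDiffWithinAt_ext_coord_change (I := I) (n := ∞) q p (y := u) (by
    rw [PartialEquiv.trans_source]
    exact ⟨hu, hq⟩)
  rwa [I.range_eq_univ, contDiffWithinAt_univ] at h

theorem eventually_mem_target {p : M} {u : F} (hu : u ∈ (extChartAt I p).target) :
    ∀ᶠ v in 𝓝 u, v ∈ (extChartAt I p).target :=
  (isOpen_extChartAt_target p).mem_nhds hu

variable [IsManifold I ∞ M]

theorem isInvertible_chartFrame {p : M} {u : F} (hu : u ∈ (extChartAt I p).target) :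
    (chartFrame I p u).IsInvertible := by
  have : IsManifold I 1 M := isManifold_one
  have h := isInvertible_mfderivWithin_extChartAt_symm hu
  rwa [I.range_eq_univ, mfderivWithin_univ] at h

theorem mdifferentiableAt_symm {p : M} {u : F} (hu : u ∈ (extChartAt I p).target) :
    MDifferentiableAt 𝓘(ℝ, F) I (extChartAt I p).symm u := by
  have : IsManifold I 1 M := isManifold_one
  have h := mdifferentiableWithinAt_extChartAt_symm hu
  rwa [I.range_eq_univ, mdifferentiableWithinAt_univ] at h

theorem chartFrame_self (p : M) (a : F) :
    (chartFrame I p (extChartAt I p p) a : F) = a := by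
  have : IsManifold I 1 M := isManifold_one
  have h := mfderivWithin_range_extChartAt_symm (I := I) (x := p)
  rw [I.range_eq_univ, mfderivWithin_univ] at h
  exact congrArg (fun L : F →L[ℝ] F => L a) h

/-- Chain rule for the inverse chart at p, which near u is the inverse chart at q composed with the
transition map. -/
theorem chartFrame_transition {p q : M} {u : F} (hu : u ∈ (extChartAt I p).target)
    (hq : (extChartAt I p).symm u ∈ (extChartAt I q).source) (a : F) :
    (chartFrame I q (transition I p q u) (fderiv ℝ (transition I p q) u a) : F)
      = chartFrame I p u a := by
  have : IsManifold I 1 M := isManifold_one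
  have hd : DifferentiableAt ℝ (transition I p q) u :=
    (contDiffAt_transition hu hq).differentiableAt (by simp)
  have hm : transition I p q u ∈ (extChartAt I q).target := (extChartAt I q).map_source hq
  have he : (extChartAt I p).symm =ᶠ[𝓝 u] (extChartAt I q).symm ∘ transition I p q := by
    filter_upwards [eventually_symm_mem_source hu hq] with v hv
    exact ((extChartAt I q).left_inv hv).symm
  obtain ⟨D, hD⟩ : ∃ D : F →L[ℝ] F, D = fderiv ℝ (transition I p q) u := ⟨_, rfl⟩
  rw [← hD]
  have hψ : HasMFDerivAt 𝓘(ℝ, F) 𝓘(ℝ, F) (transition I p q) u D :=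
    hasMFDerivAt_iff_hasFDerivAt.2 (hD ▸ hd.hasFDerivAt)
  have h1 : HasMFDerivAt 𝓘(ℝ, F) I ((extChartAt I q).symm ∘ transition I p q) u
      ((chartFrame I q (transition I p q u)).comp D) :=
    (mdifferentiableAt_symm hm).hasMFDerivAt.comp u hψ
  have h2 := h1.congr_of_eventuallyEq he
  have h3 := h2.mfderiv
  exact congrArg (fun L : F →L[ℝ] F => L a) h3.symm

theorem isInvertible_fderiv_transition {p q : M} {u : F} (hu : u ∈ (extChartAt I p).target)
    (hq : (extChartAt I p).symm u ∈ (extChartAt I q).source) :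
    (fderiv ℝ (transition I p q) u).IsInvertible := by
  obtain ⟨e, he⟩ := isInvertible_chartFrame hu
  obtain ⟨f, hf⟩ := isInvertible_chartFrame (I := I) (p := q) (u := transition I p q u)
    ((extChartAt I q).map_source hq)
  let e' : F ≃L[ℝ] F := e
  let f' : F ≃L[ℝ] F := f
  refine ⟨e'.trans f'.symm, ?_⟩
  ext a
  apply f'.injective
  have h := chartFrame_transition hu hq a
  rw [← he, ← hf] at h
  exact (f'.apply_symm_apply (e' a)).trans h.symm

/-- Pass to the chart centred at the image point, where the frame is the identity. -/
theorem chartFrame_eq_fderiv {p : M} {u : F}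
    (hu : u ∈ (extChartAt I p).target) (a : F) : (chartFrame I p u a : F) =
      fderiv ℝ (transition I p ((extChartAt I p).symm u)) u a := by
  rw [← chartFrame_transition hu (mem_extChartAt_source ((extChartAt I p).symm u))]
  exact chartFrame_self (I := I) _ _

/-- Transformation law of the coordinate expression of a metric. -/
theorem metricInChart_transition
    (G : ∀ q : M, TangentSpace I q →L[ℝ] TangentSpace I q →L[ℝ] ℝ) {p q : M} {u : F}
    (hu : u ∈ (extChartAt I p).target)
    (hq : (extChartAt I p).symm u ∈ (extChartAt I q).source) :
    metricInChart G p u =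
      pullBilin (metricInChart G q (transition I p q u)) (fderiv ℝ (transition I p q) u) := by
  ext a b
  -- The two base points are equal but not definitionally; all fibres are read as F so that the
  -- forms can be compared.
  have key : ∀ r s : M, r = s → ∀ a b : F, (G r : F →L[ℝ] F →L[ℝ] ℝ) a b =
      (G s : F →L[ℝ] F →L[ℝ] ℝ) a b := by
    rintro r s rfl a b; rfl
  rw [pullBilin_apply, metricInChart_apply, metricInChart_apply]
  refine Eq.trans ?_ (key _ _ ((extChartAt I q).left_inv hq).symm _ _)
  exact congrArg₂ (fun x y : F => (G ((extChartAt I p).symm u) : F →L[ℝ] F →L[ℝ] ℝ) x y)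
    (chartFrame_transition hu hq a).symm (chartFrame_transition hu hq b).symm

/-- A nondegenerate symmetric metric with smooth coordinate expressions. -/
structure IsSmoothMetric (G : ∀ q : M, TangentSpace I q →L[ℝ] TangentSpace I q →L[ℝ] ℝ) :
    Prop where
  symm : ∀ q a b, G q a b = G q b a
  contDiffAt : ∀ {p : M} {u : F}, u ∈ (extChartAt I p).target →
    ContDiffAt ℝ ∞ (metricInChart G p) u
  isInvertible : ∀ {p : M} {u : F}, u ∈ (extChartAt I p).target →
    (metricInChart G p u).IsInvertible

namespace IsSmoothMetric

variable {G : ∀ q : M, TangentSpace I q →L[ℝ] TangentSpace I q →L[ℝ] ℝ}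

omit [I.Boundaryless] [IsManifold I ∞ M] in
theorem contDiffAt_christoffel [FiniteDimensional ℝ F] (hG : IsSmoothMetric G) {p : M} {u : F}
    (hu : u ∈ (extChartAt I p).target) : ContDiffAt ℝ ∞ (christoffel G p) u :=
  ContDiffAt.christoffelSymbol (n := ∞) (hG.contDiffAt hu) (hG.isInvertible hu)

/-- Transformation law of the Christoffel symbols. -/
theorem christoffel_transition (hG : IsSmoothMetric G) {p q : M} {u : F}
    (hu : u ∈ (extChartAt I p).target)
    (hq : (extChartAt I p).symm u ∈ (extChartAt I q).source) (a b : F) :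
    fderiv ℝ (transition I p q) u (christoffel G p u a b) =
      christoffel G q (transition I p q u)
          (fderiv ℝ (transition I p q) u a) (fderiv ℝ (transition I p q) u b)
        + fderiv ℝ (fderiv ℝ (transition I p q)) u a b := by
  have hm : transition I p q u ∈ (extChartAt I q).target :=
    (extChartAt I q).map_source hq
  refine christoffelSymbol_pullback
    ((hG.contDiffAt hm).differentiableAt (by simp))
    (Eventually.of_forall fun v a b => hG.symm _ _ _)
    ((contDiffAt_transition hu hq).of_le ENat.LEInfty.out)
    ((hG.contDiffAt hu).differentiableAt (by simp)) ?_
    (hG.isInvertible hm) (hG.isInvertible hu)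
    (isInvertible_fderiv_transition hu hq) a b
  filter_upwards [eventually_mem_target hu, eventually_symm_mem_source hu hq] with z h1 h2
  exact metricInChart_transition G h1 h2

end IsSmoothMetric

theorem fieldInChart_self (Y : ∀ q : M, TangentSpace I q) (p : M) :
    fieldInChart Y p (extChartAt I p p) = (Y p : F) := by
  have : IsManifold I 1 M := isManifold_one
  have h := mfderivWithin_range_extChartAt_symm (I := I) (x := p)
  rw [I.range_eq_univ, mfderivWithin_univ] at h
  have h1 : (chartFrame I p (extChartAt I p p) : F →L[ℝ] F) = ContinuousLinearMap.id ℝ F := h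
  have h2 : ∀ r s : M, r = s → (Y r : F) = Y s := by rintro r s rfl; rfl
  exact (inverse_apply_of_eq_id (F := F) h1 _).trans (h2 _ _ (extChartAt_to_inv p))

theorem chartFrame_fieldInChart (Y : ∀ q : M, TangentSpace I q) {p : M} {u : F}
    (hu : u ∈ (extChartAt I p).target) :
    chartFrame I p u (fieldInChart Y p u) = Y ((extChartAt I p).symm u) :=
  (isInvertible_chartFrame hu).self_apply_inverse _

theorem fieldInChart_eq_iff (Y : ∀ q : M, TangentSpace I q) {p : M} {u : F}
    (hu : u ∈ (extChartAt I p).target) (a : F) :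
    fieldInChart Y p u = a ↔ Y ((extChartAt I p).symm u) = chartFrame I p u a := by
  obtain ⟨e, he⟩ := isInvertible_chartFrame hu
  rw [fieldInChart, ← he, ContinuousLinearMap.inverse_equiv]
  exact e.symm_apply_eq

/-- The chart expression is the pullback of the field by the inverse chart. -/
theorem differentiableAt_fieldInChart [CompleteSpace F] {Y : ∀ q : M, TangentSpace I q}
    (hY : ContMDiff I I.tangent ∞ (fun q => (⟨q, Y q⟩ : TangentBundle I M))) (p : M) :
    DifferentiableAt ℝ (fieldInChart Y p) (extChartAt I p p) := by
  have : IsManifold I 2 M := IsManifold.of_le (n := ∞) ENat.LEInfty.out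
  have h := MDifferentiableWithinAt.differentiableWithinAt_mpullbackWithin_vectorField
    (s := Set.univ) ((hY p).mdifferentiableAt (by simp)).mdifferentiableWithinAt
  rw [I.range_eq_univ, Set.preimage_univ, Set.univ_inter, VectorField.mpullbackWithin_univ] at h
  exact differentiableWithinAt_univ.1 h

/-- The manifold bracket is transported from the bracket of the chart expressions, and at the centre
of the chart the transport is the identity. -/
theorem mlieBracket_eq (X Y : ∀ q : M, TangentSpace I q) (p : M) :
    (VectorField.mlieBracket I X Y p : F) =
      fderiv ℝ (fieldInChart Y p) (extChartAt I p p) (X p)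
        - fderiv ℝ (fieldInChart X p) (extChartAt I p p) (Y p) := by
  have : IsManifold I 1 M := isManifold_one
  have h : (mfderiv I 𝓘(ℝ, F) (extChartAt I p) p : F →L[ℝ] F) = ContinuousLinearMap.id ℝ F :=
    mfderiv_extChartAt_self (I := I) (x := p)
  rw [← VectorField.mlieBracketWithin_univ, VectorField.mlieBracketWithin_apply]
  rw [I.range_eq_univ, Set.preimage_univ, Set.univ_inter, VectorField.mpullbackWithin_univ,
    VectorField.mpullbackWithin_univ]
  have h2 : VectorField.lieBracketWithin ℝ (fieldInChart X p) (fieldInChart Y p) Set.univ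
      (extChartAt I p p) = fderiv ℝ (fieldInChart Y p) (extChartAt I p p) (X p)
        - fderiv ℝ (fieldInChart X p) (extChartAt I p p) (Y p) := by
    rw [VectorField.lieBracketWithin_univ, VectorField.lieBracket, fieldInChart_self,
      fieldInChart_self]
  exact (inverse_apply_of_eq_id (F := F) h _).trans h2

theorem weylConnection_eq (G : ∀ q : M, TangentSpace I q →L[ℝ] TangentSpace I q →L[ℝ] ℝ)
    (θ : ∀ q : M, TangentSpace I q →L[ℝ] ℝ) (X Y : ∀ q : M, TangentSpace I q) (p : M) :
    (weylConnection G θ X Y p : F) = fderiv ℝ (fieldInChart Y p) (extChartAt I p p) (X p)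
      + weylSymbol G θ p (X p) (Y p) := by
  rw [weylConnection]
  refine (ofChartCoords_apply (I := I) p _).trans ?_
  rw [fieldInChart_self, fieldInChart_self]

/-- The Weyl connection is torsion-free. -/
theorem weylConnection_sub
    {G : ∀ q : M, TangentSpace I q →L[ℝ] TangentSpace I q →L[ℝ] ℝ}
    (hG : IsSmoothMetric G)
    (θ : ∀ q : M, TangentSpace I q →L[ℝ] ℝ) (X Y : ∀ q : M, TangentSpace I q) (p : M) :
    (weylConnection G θ X Y p : F) - (weylConnection G θ Y X p : F)
      = (VectorField.mlieBracket I X Y p : F) := by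
  have hs' : ∀ u a b, metricInChart G p u a b = metricInChart G p u b a := fun u a b => by
    rw [metricInChart_apply, metricInChart_apply, hG.symm]
  -- Only the symmetry of the symbols matters, so θ may be arbitrary and need not be smooth.
  have sym : ∀ a b, weylSymbol G θ p a b = weylSymbol G θ p b a := by
    intro a b
    rw [weylSymbol, weylSymbol, christoffel_eq,
      christoffelSymbol_symm ((hG.contDiffAt (mem_extChartAt_target p)).differentiableAt
        (by simp)) (Eventually.of_forall hs') a b, hs' _ a b,
      add_comm (formInChart θ p _ a • b)]
  rw [weylConnection_eq, weylConnection_eq, mlieBracket_eq, sym (X p) (Y p)]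
  abel

end Charts

/-! ### Induced coordinates on TN; the Sasaki metric and vertical projector in them. -/

section TangentCharts

variable {E : Type*} [NormedAddCommGroup E] [NormedSpace ℝ E]
  {N : Type*} [TopologicalSpace N] [ChartedSpace E N] [IsManifold 𝓘(ℝ, E) ∞ N]

theorem mem_tangentChart_target (v : TangentBundle 𝓘(ℝ, E) N) (u : E × E) :
    u ∈ (extChartAt 𝓘(ℝ, E).tangent v).target ↔
      u.1 ∈ (extChartAt 𝓘(ℝ, E) v.proj).target := by
  rw [FiberBundle.extChartAt_target]
  refine ⟨fun h => h.1.1, fun h => ⟨⟨h, ?_⟩, Set.mem_univ _⟩⟩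
  have h1 := (extChartAt 𝓘(ℝ, E) v.proj).map_target h
  rwa [extChartAt_source] at h1

/-- On each fibre, the inverse of the trivialization is the derivative of the inverse base chart. -/
theorem tangentChart_symm (v : TangentBundle 𝓘(ℝ, E) N) {u : E × E}
    (hu : u.1 ∈ (extChartAt 𝓘(ℝ, E) v.proj).target) :
    (extChartAt 𝓘(ℝ, E).tangent v).symm u =
      ⟨(extChartAt 𝓘(ℝ, E) v.proj).symm u.1, chartFrame 𝓘(ℝ, E) v.proj u.1 u.2⟩ := by
  have : IsManifold 𝓘(ℝ, E) 1 N := isManifold_one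
  have hb := (extChartAt 𝓘(ℝ, E) v.proj).map_target hu
  have hb' := hb
  rw [extChartAt_source] at hb'
  rw [FiberBundle.extChartAt]
  have h1 := (trivializationAt E (TangentSpace 𝓘(ℝ, E)) v.proj).mk_symm (b :=
    (extChartAt 𝓘(ℝ, E) v.proj).symm u.1) hb' u.2
  refine h1.symm.trans ?_
  have h2 := TangentBundle.symmL_trivializationAt (I := 𝓘(ℝ, E)) hb'
  have h3 := congrArg (fun L => L u.2) h2
  rw [Bundle.Trivialization.symmL_apply _ hb'] at h3
  rw [h3, ModelWithCorners.range_eq_univ, mfderivWithin_univ,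
    (extChartAt 𝓘(ℝ, E) v.proj).right_inv hu]
  rfl

theorem tangentChart_symm_proj (v : TangentBundle 𝓘(ℝ, E) N) {u : E × E}
    (hu : u.1 ∈ (extChartAt 𝓘(ℝ, E) v.proj).target) :
    ((extChartAt 𝓘(ℝ, E).tangent v).symm u).proj = (extChartAt 𝓘(ℝ, E) v.proj).symm u.1 := by
  rw [tangentChart_symm v hu]

/-- The change of induced coordinates is `(x, y) ↦ (ψ x, Dψ(x) y)`. -/
theorem tangent_transition (v w : TangentBundle 𝓘(ℝ, E) N) {u : E × E}
    (hu : u.1 ∈ (extChartAt 𝓘(ℝ, E) v.proj).target)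
    (hq : (extChartAt 𝓘(ℝ, E) v.proj).symm u.1 ∈ (extChartAt 𝓘(ℝ, E) w.proj).source) :
    transition 𝓘(ℝ, E).tangent v w u = (transition 𝓘(ℝ, E) v.proj w.proj u.1,
      fderiv ℝ (transition 𝓘(ℝ, E) v.proj w.proj) u.1 u.2) := by
  have hm : transition 𝓘(ℝ, E) v.proj w.proj u.1 ∈ (extChartAt 𝓘(ℝ, E) w.proj).target :=
    (extChartAt 𝓘(ℝ, E) w.proj).map_source hq
  rw [← (extChartAt 𝓘(ℝ, E).tangent w).right_inv ((mem_tangentChart_target w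
      (transition 𝓘(ℝ, E) v.proj w.proj u.1, _)).2 hm), transition_apply (I := 𝓘(ℝ, E).tangent),
    tangentChart_symm v hu, tangentChart_symm w hm]
  congr 1
  have key : ∀ (r s : N) (a b : E), r = s → a = b →
      (⟨r, a⟩ : TangentBundle 𝓘(ℝ, E) N) = ⟨s, b⟩ := by
    rintro r s a b rfl rfl; rfl
  exact key _ _ _ _ ((extChartAt 𝓘(ℝ, E) w.proj).left_inv hq).symm
    (chartFrame_transition hu hq u.2).symm

/-- The D²ψ term is what prevents dy from being tensorial; it is later compensated by the
Christoffel symbols. -/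
theorem fderiv_tangent_transition (v w : TangentBundle 𝓘(ℝ, E) N) {u : E × E}
    (hu : u.1 ∈ (extChartAt 𝓘(ℝ, E) v.proj).target)
    (hq : (extChartAt 𝓘(ℝ, E) v.proj).symm u.1 ∈ (extChartAt 𝓘(ℝ, E) w.proj).source)
    (a : E × E) :
    fderiv ℝ (transition 𝓘(ℝ, E).tangent v w) u a =
      (fderiv ℝ (transition 𝓘(ℝ, E) v.proj w.proj) u.1 a.1,
        fderiv ℝ (fderiv ℝ (transition 𝓘(ℝ, E) v.proj w.proj)) u.1 a.1 u.2
          + fderiv ℝ (transition 𝓘(ℝ, E) v.proj w.proj) u.1 a.2) := by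
  set ψ := transition 𝓘(ℝ, E) v.proj w.proj with hψ
  have hc : ContDiffAt ℝ ∞ ψ u.1 := contDiffAt_transition hu hq
  have e : transition 𝓘(ℝ, E).tangent v w =ᶠ[𝓝 u] fun z : E × E => (ψ z.1, fderiv ℝ ψ z.1 z.2) := by
    filter_upwards [continuousAt_fst.eventually (eventually_mem_target hu),
      continuousAt_fst.eventually (eventually_symm_mem_source hu hq)] with z h1 h2
    exact tangent_transition v w h1 h2
  have d1 : HasFDerivAt (fun z : E × E => ψ z.1) _ u :=
    (hc.differentiableAt (by simp)).hasFDerivAt.comp u hasFDerivAt_fst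
  have d2 : HasFDerivAt (fun z : E × E => fderiv ℝ ψ z.1) _ u :=
    ((hc.fderiv_right (m := ∞) le_rfl).differentiableAt
      (by simp)).hasFDerivAt.comp u hasFDerivAt_fst
  rw [e.fderiv_eq, (d1.prodMk (d2.clm_apply hasFDerivAt_snd)).fderiv]
  simp [add_comm]

/-- Coordinate vector fields are smooth because they arise from the smooth inverse chart of TN with
the fibre coordinate frozen; the smooth metric is then evaluated on two of them. -/
theorem contDiffAt_metricInChart [FiniteDimensional ℝ E] (g : RiemMetric E N) {p : N} {u : E}
    (hu : u ∈ (extChartAt 𝓘(ℝ, E) p).target) :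
    ContDiffAt ℝ ∞ (metricInChart g.inner p) u := by
  simp only [contDiffAt_clm_apply_iff]
  intro a b
  have hs : ContMDiffAt 𝓘(ℝ, E) 𝓘(ℝ, E) ∞ (extChartAt 𝓘(ℝ, E) p).symm u :=
    (contMDiffOn_extChartAt_symm p).contMDiffAt ((isOpen_extChartAt_target p).mem_nhds hu)
  have hf : ∀ a : E, ContMDiffAt 𝓘(ℝ, E) 𝓘(ℝ, E).tangent ∞ (fun z : E =>
      (⟨(extChartAt 𝓘(ℝ, E) p).symm z, chartFrame 𝓘(ℝ, E) p z a⟩ : TangentBundle 𝓘(ℝ, E) N)) u := by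
    intro a
    let v : TangentBundle 𝓘(ℝ, E) N := ⟨p, 0⟩
    have h1 : ContMDiffAt 𝓘(ℝ, E × E) 𝓘(ℝ, E).tangent ∞ (extChartAt 𝓘(ℝ, E).tangent v).symm
        (u, a) := (contMDiffOn_extChartAt_symm v).contMDiffAt
          ((isOpen_extChartAt_target v).mem_nhds ((mem_tangentChart_target v (u, a)).2 hu))
    have h2 : ContMDiffAt 𝓘(ℝ, E) 𝓘(ℝ, E × E) ∞ (fun z : E => (z, a)) u :=
      (contDiffAt_id.prodMk contDiffAt_const).contMDiffAt
    refine (h1.comp u h2).congr_of_eventuallyEq ?_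
    filter_upwards [eventually_mem_target hu] with z hz
    exact (tangentChart_symm v (u := (z, a)) hz).symm
  have h := ContMDiffAt.clm_bundle_apply₂ (F₃ := ℝ) (E₃ := Bundle.Trivial N ℝ)
    (ψ := fun z => g.inner ((extChartAt 𝓘(ℝ, E) p).symm z))
    ((g.contMDiff _).comp u hs) (hf a) (hf b)
  have h' := (Bundle.contMDiffAt_totalSpace.1 h).2
  exact h'.contDiffAt

theorem metricInChart_symm (g : RiemMetric E N) (p : N) (u a b : E) :
    metricInChart g.inner p u a b = metricInChart g.inner p u b a := g.symm _ _ _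

theorem metricInChart_pos (g : RiemMetric E N) {p : N} {u : E}
    (hu : u ∈ (extChartAt 𝓘(ℝ, E) p).target) {a : E} (ha : a ≠ 0) :
    0 < metricInChart g.inner p u a a := by
  refine g.pos _ _ fun h => ha ?_
  obtain ⟨e, he⟩ := isInvertible_chartFrame hu
  rw [← he] at h
  exact e.map_eq_zero_iff.1 h

theorem dx_apply (v : TangentBundle 𝓘(ℝ, E) N) (a : E × E) : dx v a = a.1 :=
  congrArg Prod.fst (chartCoords_apply (I := 𝓘(ℝ, E).tangent) v a)

theorem deltaY_apply (g : RiemMetric E N) (v : TangentBundle 𝓘(ℝ, E) N) (a : E × E) :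
    deltaY g v a = deltaForm (christoffel g.inner v.proj) (xyCoords v) a := by
  have h := congrArg Prod.snd (chartCoords_apply (I := 𝓘(ℝ, E).tangent) v a)
  have h1 : deltaY g v a = dy v a + nonlinearConnection g v (dx v a) := rfl
  rw [h1, dx_apply]
  exact congrArg (· + _) h

theorem verticalProjector_apply (g : RiemMetric E N) (v : TangentBundle 𝓘(ℝ, E) N) (a : E × E) :
    (verticalProjector g v a : E × E) = (0, deltaY g v a) :=
  ofChartCoords_apply (I := 𝓘(ℝ, E).tangent) v _

variable [FiniteDimensional ℝ E] (g : RiemMetric E N)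

theorem metricInChart_isInvertible {p : N} {u : E} (hu : u ∈ (extChartAt 𝓘(ℝ, E) p).target) :
    (metricInChart g.inner p u).IsInvertible :=
  isInvertible_of_pos _ fun _ ha => metricInChart_pos g hu ha

theorem isSmoothMetric_inner : IsSmoothMetric g.inner where
  symm := g.symm
  contDiffAt := contDiffAt_metricInChart g
  isInvertible := metricInChart_isInvertible g

/-- The forms `δy^a` transform as vectors under a change of induced coordinates. -/
theorem deltaY_chartFrame {v : TangentBundle 𝓘(ℝ, E) N} {u : E × E}
    (hu : u ∈ (extChartAt 𝓘(ℝ, E).tangent v).target) (a : E × E) :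
    deltaY g ((extChartAt 𝓘(ℝ, E).tangent v).symm u) (chartFrame 𝓘(ℝ, E).tangent v u a) =
      fderiv ℝ (transition 𝓘(ℝ, E) v.proj ((extChartAt 𝓘(ℝ, E).tangent v).symm u).proj) u.1
        (deltaForm (christoffel g.inner v.proj) u a) := by
  have hu1 := (mem_tangentChart_target v u).1 hu
  set w := (extChartAt 𝓘(ℝ, E).tangent v).symm u with hw
  have hq : (extChartAt 𝓘(ℝ, E) v.proj).symm u.1 ∈ (extChartAt 𝓘(ℝ, E) w.proj).source := by
    rw [← tangentChart_symm_proj v hu1]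
    exact mem_extChartAt_source _
  have hxy : xyCoords w = transition 𝓘(ℝ, E).tangent v w u := rfl
  have hf : (chartFrame 𝓘(ℝ, E).tangent v u a : E × E) = _ := chartFrame_eq_fderiv hu a
  refine (deltaY_apply g w _).trans ?_
  rw [hf, ← hw, hxy, tangent_transition v w hu1 hq, fderiv_tangent_transition v w hu1 hq]
  simp only [deltaForm_apply, connectionCoeff, ContinuousLinearMap.flip_apply, map_add]
  -- The inhomogeneous D²ψ term of the Christoffel law matches the one in the derivative of the
  -- transition of TN.
  rw [(isSmoothMetric_inner g).christoffel_transition hu1 hq]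
  abel

/-- The Sasaki metric in induced coordinates. -/
theorem metricInChart_sasaki {v : TangentBundle 𝓘(ℝ, E) N} {u : E × E}
    (hu : u ∈ (extChartAt 𝓘(ℝ, E).tangent v).target) :
    metricInChart (sasakiMetric g) v u =
      sasakiForm (metricInChart g.inner v.proj) (christoffel g.inner v.proj) u := by
  have hu1 := (mem_tangentChart_target v u).1 hu
  refine ContinuousLinearMap.ext fun a => ContinuousLinearMap.ext fun b => ?_
  rw [metricInChart_apply]
  have hd := deltaY_chartFrame g hu
  set w := (extChartAt 𝓘(ℝ, E).tangent v).symm u with hw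
  have hq : (extChartAt 𝓘(ℝ, E) v.proj).symm u.1 ∈ (extChartAt 𝓘(ℝ, E) w.proj).source := by
    rw [← tangentChart_symm_proj v hu1]
    exact mem_extChartAt_source _
  have hxy : (xyCoords w).1 = transition 𝓘(ℝ, E) v.proj w.proj u.1 :=
    congrArg Prod.fst (tangent_transition v w hu1 hq)
  have hx : ∀ a : E × E, dx w (chartFrame 𝓘(ℝ, E).tangent v u a) =
      fderiv ℝ (transition 𝓘(ℝ, E) v.proj w.proj) u.1 a.1 := by
    intro a
    have hf : (chartFrame 𝓘(ℝ, E).tangent v u a : E × E) = _ := chartFrame_eq_fderiv hu a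
    refine (dx_apply w _).trans ?_
    rw [hf, ← hw, fderiv_tangent_transition v w hu1 hq]
  have h1 : sasakiMetric g w (chartFrame 𝓘(ℝ, E).tangent v u a)
      (chartFrame 𝓘(ℝ, E).tangent v u b) =
      metricInChart g.inner w.proj (xyCoords w).1 (dx w (chartFrame 𝓘(ℝ, E).tangent v u a))
        (dx w (chartFrame 𝓘(ℝ, E).tangent v u b)) +
      metricInChart g.inner w.proj (xyCoords w).1 (deltaY g w (chartFrame 𝓘(ℝ, E).tangent v u a))
        (deltaY g w (chartFrame 𝓘(ℝ, E).tangent v u b)) := rfl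
  refine h1.trans ?_
  rw [hd, hd, hx, hx, hxy, sasakiForm_apply, metricInChart_transition g.inner hu1 hq]
  rfl

omit [FiniteDimensional ℝ E] in
theorem sasakiMetric_symm (v : TangentBundle 𝓘(ℝ, E) N) (a b) :
    sasakiMetric g v a b = sasakiMetric g v b a := by
  have h : ∀ a b, sasakiMetric g v a b =
      metricInChart g.inner v.proj (xyCoords v).1 (dx v a) (dx v b) +
      metricInChart g.inner v.proj (xyCoords v).1 (deltaY g v a) (deltaY g v b) := fun _ _ => rfl
  rw [h, h, metricInChart_symm g _ _ (dx v a), metricInChart_symm g _ _ (deltaY g v a)]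

theorem isSmoothMetric_sasakiMetric : IsSmoothMetric (sasakiMetric g) where
  symm := sasakiMetric_symm g
  contDiffAt {v u} hu := by
    have hu1 := (mem_tangentChart_target v u).1 hu
    refine (((isSmoothMetric_inner g).contDiffAt hu1).sasakiForm
      ((isSmoothMetric_inner g).contDiffAt_christoffel hu1)).congr_of_eventuallyEq ?_
    filter_upwards [eventually_mem_target (I := 𝓘(ℝ, E).tangent) hu] with z hz
    exact metricInChart_sasaki g hz
  isInvertible {v u} hu := by
    rw [metricInChart_sasaki g hu]
    exact sasakiForm_isInvertible fun a =>
      metricInChart_pos g ((mem_tangentChart_target v u).1 hu)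

/-- The vertical projector in induced coordinates. -/
theorem fieldInChart_verticalProjector
    (X : ∀ v : TangentBundle 𝓘(ℝ, E) N, TangentSpace 𝓘(ℝ, E).tangent v)
    {v : TangentBundle 𝓘(ℝ, E) N} {u : E × E}
    (hu : u ∈ (extChartAt 𝓘(ℝ, E).tangent v).target) :
    fieldInChart (fun w => verticalProjector g w (X w)) v u =
      (0, deltaForm (christoffel g.inner v.proj) u (fieldInChart X v u)) := by
  have hu1 := (mem_tangentChart_target v u).1 hu
  rw [fieldInChart_eq_iff _ hu, ← chartFrame_fieldInChart X hu]
  refine (verticalProjector_apply g _ _).trans ?_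
  have hq : (extChartAt 𝓘(ℝ, E) v.proj).symm u.1 ∈ (extChartAt 𝓘(ℝ, E)
      ((extChartAt 𝓘(ℝ, E).tangent v).symm u).proj).source := by
    rw [← tangentChart_symm_proj v hu1]
    exact mem_extChartAt_source _
  -- On a vertical vector the D²ψ term vanishes, so only Dψ acts on the fibre component.
  refine Eq.trans ?_ (chartFrame_eq_fderiv hu _).symm
  rw [deltaY_chartFrame g hu, fderiv_tangent_transition _ _ hu1 hq, map_zero,
    map_zero, zero_apply, zero_add]

end TangentCharts

/-! ### Brackets of vertical and horizontal parts in coordinates. -/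

section BracketCalculus

variable {E : Type*} [NormedAddCommGroup E] [NormedSpace ℝ E]

/-- The vertical part of a vector field, in coordinates. -/
def verticalPart (Γ : E → E →L[ℝ] E →L[ℝ] E) (f : E × E → E × E) (u : E × E) : E × E :=
  (0, deltaForm Γ u (f u))

/-- The horizontal part of a vector field, in coordinates. -/
def horizontalPart (Γ : E → E →L[ℝ] E →L[ℝ] E) (f : E × E → E × E) (u : E × E) : E × E :=
  horizontalLift Γ u (f u).1

theorem verticalPart_add_horizontalPart (Γ : E → E →L[ℝ] E →L[ℝ] E) (f : E × E → E × E) :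
    verticalPart Γ f + horizontalPart Γ f = f := by
  ext u <;> simp [verticalPart, horizontalPart, horizontalLift]

variable [FiniteDimensional ℝ E] {Γ : E → E →L[ℝ] E →L[ℝ] E} {f k : E × E → E × E} {u : E × E}

theorem differentiableAt_verticalPart (hΓ : ContDiffAt ℝ 1 Γ u.1) (hf : DifferentiableAt ℝ f u) :
    DifferentiableAt ℝ (verticalPart Γ f) u :=
  (differentiableAt_const (0 : E)).prodMk
    ((hΓ.deltaForm.differentiableAt one_ne_zero).clm_apply hf)

theorem hasFDerivAt_horizontalPart (hΓ : ContDiffAt ℝ 1 Γ u.1) (hf : DifferentiableAt ℝ f u) :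
    HasFDerivAt (horizontalPart Γ f) (((ContinuousLinearMap.fst ℝ E E).comp (fderiv ℝ f u)).prod
      (-(connectionCoeff Γ u ∘L ((ContinuousLinearMap.fst ℝ E E).comp (fderiv ℝ f u)) +
        (fderiv ℝ (connectionCoeff Γ) u).flip (f u).1))) u := by
  have h1 : HasFDerivAt (fun v => (f v).1) _ u := hf.hasFDerivAt.fst
  exact h1.prodMk ((hΓ.connectionCoeff.differentiableAt one_ne_zero).hasFDerivAt.clm_apply h1).neg

theorem differentiableAt_horizontalPart (hΓ : ContDiffAt ℝ 1 Γ u.1)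
    (hf : DifferentiableAt ℝ f u) : DifferentiableAt ℝ (horizontalPart Γ f) u :=
  (hasFDerivAt_horizontalPart hΓ hf).differentiableAt

/-- The vertical distribution is involutive. -/
theorem lieBracket_verticalPart_fst (hΓ : ContDiffAt ℝ 1 Γ u.1) (hf : DifferentiableAt ℝ f u)
    (hk : DifferentiableAt ℝ k u) :
    (VectorField.lieBracket ℝ (verticalPart Γ f) (verticalPart Γ k) u).1 = 0 := by
  have key : ∀ f : E × E → E × E, DifferentiableAt ℝ f u → ∀ w : E × E,
      (fderiv ℝ (verticalPart Γ f) u w).1 = 0 := by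
    intro f hf w
    have h1 := (differentiableAt_const (0 : E)).hasFDerivAt.prodMk
      ((hΓ.deltaForm.differentiableAt one_ne_zero).clm_apply hf).hasFDerivAt
    have h2 : HasFDerivAt (verticalPart Γ f) _ u := h1
    rw [h2.fderiv]
    simp
  rw [VectorField.lieBracket, Prod.fst_sub, key k hk, key f hf, sub_zero]

/-- The vertical part of the bracket of two horizontal fields is minus the curvature. -/
theorem deltaForm_lieBracket_horizontalPart (hΓ : ContDiffAt ℝ 1 Γ u.1)
    (hf : DifferentiableAt ℝ f u) (hk : DifferentiableAt ℝ k u) :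
    deltaForm Γ u (VectorField.lieBracket ℝ (horizontalPart Γ f) (horizontalPart Γ k) u) =
      -horizontalCurvature Γ u (f u).1 (k u).1 := by
  -- Under δy the derivatives of the fields cancel; only derivatives of the connection coefficients
  -- survive.
  rw [VectorField.lieBracket, (hasFDerivAt_horizontalPart hΓ hf).fderiv,
    (hasFDerivAt_horizontalPart hΓ hk).fderiv]
  simp only [deltaForm_apply, horizontalCurvature, horizontalPart]
  simp
  abel

end BracketCalculus

/-! ### The torsion of the Vranceanu–Cartan connection. -/

section Torsion

variable {E : Type*} [NormedAddCommGroup E] [NormedSpace ℝ E]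
  {N : Type*} [TopologicalSpace N] [ChartedSpace E N] [IsManifold 𝓘(ℝ, E) ∞ N]

theorem fieldInChart_sub {F : Type*} [NormedAddCommGroup F] [NormedSpace ℝ F] {H : Type*}
    [TopologicalSpace H] {I : ModelWithCorners ℝ F H} {M : Type*} [TopologicalSpace M]
    [ChartedSpace H M] (X Y : ∀ q : M, TangentSpace I q) (p : M) (u : F) :
    fieldInChart (fun q => X q - Y q) p u = fieldInChart X p u - fieldInChart Y p u :=
  map_sub _ _ _

/-- A bracket depends only on the germs of the fields, so convenient local expressions may replace
the chart expressions. -/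
theorem mlieBracket_eq_lieBracket {F : Type*} [NormedAddCommGroup F] [NormedSpace ℝ F] {H : Type*}
    [TopologicalSpace H] {I : ModelWithCorners ℝ F H} {M : Type*} [TopologicalSpace M]
    [ChartedSpace H M] [I.Boundaryless] [IsManifold I ∞ M] {X Y : ∀ q : M, TangentSpace I q} {p : M}
    {a b : F → F} (ha : fieldInChart X p =ᶠ[𝓝 (extChartAt I p p)] a)
    (hb : fieldInChart Y p =ᶠ[𝓝 (extChartAt I p p)] b) :
    (VectorField.mlieBracket I X Y p : F) = VectorField.lieBracket ℝ a b (extChartAt I p p) := by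
  rw [← ha.lieBracket_vectorField_eq hb, VectorField.lieBracket, fieldInChart_self,
    fieldInChart_self]
  exact mlieBracket_eq X Y p

theorem deltaForm_verticalProjector (g : RiemMetric E N) (v : TangentBundle 𝓘(ℝ, E) N)
    (a : E × E) : (verticalProjector g v a : E × E) =
      (0, deltaForm (christoffel g.inner v.proj) (xyCoords v) a) := by
  rw [← deltaY_apply]
  exact verticalProjector_apply g v a

variable [FiniteDimensional ℝ E] (g : RiemMetric E N)

/-- The torsion of a Vranceanu connection, in terms of the values of the Weyl connection and of
the brackets of the horizontal and vertical parts. -/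
theorem vranceanu_torsion_algebra {F : Type*} [NormedAddCommGroup F] [NormedSpace ℝ F]
    (P : F →L[ℝ] F) {p₁ p₂ q₁ q₂ s₁ s₂ t₁ t₂ b vv hh : F} (hp : p₁ - p₂ = vv) (hq : q₁ - q₂ = hh)
    (hs : s₂ = -t₁) (ht : t₂ = -s₁) (hb : b = vv + t₁ + (s₁ + hh)) :
    P p₁ + (q₁ - P q₁) + P s₁ + (t₁ - P t₁) - (P p₂ + (q₂ - P q₂) + P s₂ + (t₂ - P t₂)) - b =
      P vv - vv - P hh := by
  rw [← hp, ← hq] at *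
  subst hs ht hb
  simp only [map_sub, map_neg]
  abel

/-- The torsion of the Vranceanu–Cartan connection is the curvature of the horizontal
distribution. -/
theorem torsion_vranceanuCartan
    {X Y : ∀ v : TangentBundle 𝓘(ℝ, E) N, TangentSpace 𝓘(ℝ, E).tangent v}
    (hX : ContMDiff 𝓘(ℝ, E).tangent 𝓘(ℝ, E).tangent.tangent ∞
      (fun q => (⟨q, X q⟩ : TangentBundle 𝓘(ℝ, E).tangent (TangentBundle 𝓘(ℝ, E) N))))
    (hY : ContMDiff 𝓘(ℝ, E).tangent 𝓘(ℝ, E).tangent.tangent ∞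
      (fun q => (⟨q, Y q⟩ : TangentBundle 𝓘(ℝ, E).tangent (TangentBundle 𝓘(ℝ, E) N))))
    (v : TangentBundle 𝓘(ℝ, E) N) (x y : E × E) (hx : X v = x) (hy : Y v = y) :
    (vranceanuCartan g X Y v - vranceanuCartan g Y X v
        - VectorField.mlieBracket 𝓘(ℝ, E).tangent X Y v : E × E) =
      (0, horizontalCurvature (christoffel g.inner v.proj) (xyCoords v) x.1 y.1) := by
  have : CompleteSpace (E × E) := FiniteDimensional.complete ℝ _
  have hu : xyCoords v ∈ (extChartAt 𝓘(ℝ, E).tangent v).target := mem_extChartAt_target v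
  have hΓ : ContDiffAt ℝ 1 (christoffel g.inner v.proj) (xyCoords v).1 :=
    ((isSmoothMetric_inner g).contDiffAt_christoffel ((mem_tangentChart_target v _).1 hu)).of_le
      ENat.LEInfty.out
  set Γ := christoffel g.inner v.proj with hΓdef
  set u := xyCoords v with hudef
  set VX : ∀ v : TangentBundle 𝓘(ℝ, E) N, TangentSpace 𝓘(ℝ, E).tangent v :=
    fun w => verticalProjector g w (X w) with hVX
  set VY : ∀ v : TangentBundle 𝓘(ℝ, E) N, TangentSpace 𝓘(ℝ, E).tangent v :=
    fun w => verticalProjector g w (Y w) with hVY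
  set HX : ∀ v : TangentBundle 𝓘(ℝ, E) N, TangentSpace 𝓘(ℝ, E).tangent v :=
    fun w => X w - verticalProjector g w (X w) with hHX
  set HY : ∀ v : TangentBundle 𝓘(ℝ, E) N, TangentSpace 𝓘(ℝ, E).tangent v :=
    fun w => Y w - verticalProjector g w (Y w) with hHY
  set f := fieldInChart X v with hf
  set k := fieldInChart Y v with hk
  have hfd : DifferentiableAt ℝ f u := differentiableAt_fieldInChart hX v
  have hkd : DifferentiableAt ℝ k u := differentiableAt_fieldInChart hY v
  have hV : ∀ Z : ∀ v : TangentBundle 𝓘(ℝ, E) N, TangentSpace 𝓘(ℝ, E).tangent v,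
      fieldInChart (fun w => verticalProjector g w (Z w)) v =ᶠ[𝓝 u]
        verticalPart Γ (fieldInChart Z v) := by
    intro Z
    filter_upwards [eventually_mem_target (I := 𝓘(ℝ, E).tangent) hu] with z hz
    exact fieldInChart_verticalProjector g Z hz
  have hH : ∀ Z : ∀ v : TangentBundle 𝓘(ℝ, E) N, TangentSpace 𝓘(ℝ, E).tangent v,
      fieldInChart (fun w => Z w - verticalProjector g w (Z w)) v =ᶠ[𝓝 u]
        horizontalPart Γ (fieldInChart Z v) := by
    intro Z
    filter_upwards [hV Z] with z hz
    rw [fieldInChart_sub, hz]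
    exact sub_eq_of_eq_add' (congrFun (verticalPart_add_horizontalPart Γ _) z).symm
  have hG := isSmoothMetric_sasakiMetric g
  have wV := weylConnection_sub hG (cartanForm g) VX VY v
  have wH := weylConnection_sub hG (cartanForm g) HX HY v
  have bVV := mlieBracket_eq_lieBracket (hV X) (hV Y)
  have bHH := mlieBracket_eq_lieBracket (hH X) (hH Y)
  have bHV := mlieBracket_eq_lieBracket (hH X) (hV Y)
  have bVH := mlieBracket_eq_lieBracket (hV X) (hH Y)
  have b := mlieBracket_eq_lieBracket (EventuallyEq.refl _ f) (EventuallyEq.refl _ k)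
  have vf := differentiableAt_verticalPart hΓ hfd
  have vk := differentiableAt_verticalPart hΓ hkd
  have hf' := differentiableAt_horizontalPart hΓ hfd
  have hk' := differentiableAt_horizontalPart hΓ hkd
  -- Bilinearity is applied in coordinates, where differentiability of each part is available.
  have split : VectorField.lieBracket ℝ f k u =
      VectorField.lieBracket ℝ (verticalPart Γ f) (verticalPart Γ k) u
      + VectorField.lieBracket ℝ (verticalPart Γ f) (horizontalPart Γ k) u
      + (VectorField.lieBracket ℝ (horizontalPart Γ f) (verticalPart Γ k) u
      + VectorField.lieBracket ℝ (horizontalPart Γ f) (horizontalPart Γ k) u) := by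
    conv_lhs => rw [← verticalPart_add_horizontalPart Γ f, ← verticalPart_add_horizontalPart Γ k]
    rw [VectorField.lieBracket_add_left vf hf', VectorField.lieBracket_add_right vk hk',
      VectorField.lieBracket_add_right vk hk']
  have cV := lieBracket_verticalPart_fst hΓ hfd hkd
  have cH := deltaForm_lieBracket_horizontalPart hΓ hfd hkd
  have hfu : f u = x := (fieldInChart_self X v).trans hx
  have hku : k u = y := (fieldInChart_self Y v).trans hy
  rw [hfu, hku] at cH
  have swap₁ : (VectorField.mlieBracket 𝓘(ℝ, E).tangent HY VX v : E × E) =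
      -(VectorField.mlieBracket 𝓘(ℝ, E).tangent VX HY v : E × E) :=
    VectorField.mlieBracket_swap_apply
  have swap₂ : (VectorField.mlieBracket 𝓘(ℝ, E).tangent VY HX v : E × E) =
      -(VectorField.mlieBracket 𝓘(ℝ, E).tangent HX VY v : E × E) :=
    VectorField.mlieBracket_swap_apply
  have hB : (VectorField.mlieBracket 𝓘(ℝ, E).tangent X Y v : E × E) =
      (VectorField.mlieBracket 𝓘(ℝ, E).tangent VX VY v : E × E)
      + (VectorField.mlieBracket 𝓘(ℝ, E).tangent VX HY v : E × E)
      + ((VectorField.mlieBracket 𝓘(ℝ, E).tangent HX VY v : E × E)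
      + (VectorField.mlieBracket 𝓘(ℝ, E).tangent HX HY v : E × E)) := by
    rw [b, bVV, bVH, bHV, bHH]
    exact split
  refine (vranceanu_torsion_algebra (F := E × E) (verticalProjector g v) wV wH swap₁ swap₂
    hB).trans ?_
  -- By involutivity, [VX,VY] is fixed by the vertical projector, so the first two terms of
  -- `vranceanu_torsion_algebra` cancel and only -V[HX,HY] remains.
  have cV' : (0, deltaForm Γ u (VectorField.lieBracket ℝ (verticalPart Γ f) (verticalPart Γ k) u))
      = VectorField.lieBracket ℝ (verticalPart Γ f) (verticalPart Γ k) u := by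
    refine Prod.ext cV.symm ?_
    rw [deltaForm_apply, cV, map_zero, add_zero]
  have e1 : ∀ a b c d : E × E, a = b → c = d → a - b - c = -d := by
    rintro a b c d rfl rfl
    abel
  have eV : ∀ z : E × E,
      z = VectorField.lieBracket ℝ (verticalPart Γ f) (verticalPart Γ k) u →
      (verticalProjector g v z : E × E) = z := by
    rintro z rfl
    exact (deltaForm_verticalProjector g v _).trans cV'
  have eH : ∀ z : E × E,
      z = VectorField.lieBracket ℝ (horizontalPart Γ f) (horizontalPart Γ k) u →
      (verticalProjector g v z : E × E) = (0, -horizontalCurvature Γ u x.1 y.1) := by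
    rintro z rfl
    exact (deltaForm_verticalProjector g v _).trans (congrArg (Prod.mk (0 : E)) cH)
  refine (e1 _ _ _ _ (eV _ bVV) (eH _ bHH)).trans ?_
  simp

/-- A tangent vector extends to a smooth vector field on `TN`. -/
theorem exists_smooth_vectorField [T2Space N] (v : TangentBundle 𝓘(ℝ, E) N)
    (a : TangentSpace 𝓘(ℝ, E).tangent v) :
    ∃ X : ∀ v : TangentBundle 𝓘(ℝ, E) N, TangentSpace 𝓘(ℝ, E).tangent v,
      ContMDiff 𝓘(ℝ, E).tangent 𝓘(ℝ, E).tangent.tangent ∞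
        (fun q => (⟨q, X q⟩ : TangentBundle 𝓘(ℝ, E).tangent (TangentBundle 𝓘(ℝ, E) N))) ∧
      X v = a := by
  -- The cutoff lives on N and is pulled back to TN: its support need not be compact there, but it
  -- stays over the chart domain, where the locally constant extension of the vector is smooth.
  obtain ⟨ρ⟩ : Nonempty (SmoothBumpFunction 𝓘(ℝ, E) v.proj) := inferInstance
  let t := trivializationAt (E × E) (TangentSpace 𝓘(ℝ, E).tangent) v
  have hsrc : t.baseSet = Bundle.TotalSpace.proj ⁻¹' (chartAt E v.proj).source := by
    ext w
    exact TangentBundle.mem_chart_source_iff w v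
  have hρ : ContMDiff 𝓘(ℝ, E).tangent 𝓘(ℝ, ℝ) ∞ fun w : TangentBundle 𝓘(ℝ, E) N => ρ w.proj :=
    ρ.contMDiff.comp (Bundle.contMDiff_proj _)
  have hsec : ContMDiffOn 𝓘(ℝ, E).tangent 𝓘(ℝ, E).tangent.tangent ∞
      (fun q => (⟨q, FiberBundle.extend (E × E) a q⟩ :
        TangentBundle 𝓘(ℝ, E).tangent (TangentBundle 𝓘(ℝ, E) N))) t.baseSet := by
    intro x hx
    rw [t.contMDiffWithinAt_section _ hx]
    have h1 : ContMDiffOn 𝓘(ℝ, E).tangent 𝓘(ℝ, E × E) ∞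
      (fun _ : TangentBundle 𝓘(ℝ, E) N => (t ⟨v, a⟩).2) t.baseSet := contMDiffOn_const
    exact (h1.congr (fun x hx => by
      have h : (t ⟨x, t.symm x (t ⟨v, a⟩).2⟩).2 = (t ⟨v, a⟩).2 := by rw [t.apply_mk_symm hx]
      exact h)) x hx
  refine ⟨fun w => ρ w.proj • FiberBundle.extend (E × E) a w, ?_, ?_⟩
  · refine ContMDiffOn.smul_section_of_tsupport (hρ.contMDiffOn (s := t.baseSet)) t.open_baseSet
      ?_ hsec
    rw [hsrc]
    refine (closure_minimal ?_ ((isClosed_tsupport ρ).preimage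
      (FiberBundle.continuous_proj E (TangentSpace 𝓘(ℝ, E))))).trans
      (Set.preimage_mono ρ.tsupport_subset_chartAt_source)
    exact fun w hw => subset_tsupport ρ hw
  · simp

/-- Fields with prescribed values at v realize every pair (a, c); only their dx-components enter the
torsion. -/
theorem isTorsionFree_iff [T2Space N] :
    IsTorsionFree (vranceanuCartan g) ↔ ∀ (v : TangentBundle 𝓘(ℝ, E) N) (a c : E),
      horizontalCurvature (christoffel g.inner v.proj) (xyCoords v) a c = 0 := by
  constructor
  · intro h v a c
    obtain ⟨X, hX, hXv⟩ := exists_smooth_vectorField v ((a, 0) : E × E)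
    obtain ⟨Y, hY, hYv⟩ := exists_smooth_vectorField v ((c, 0) : E × E)
    have h1 := torsion_vranceanuCartan g hX hY v (a, 0) (c, 0) hXv hYv
    have h2 : (vranceanuCartan g X Y v - vranceanuCartan g Y X v
        - VectorField.mlieBracket 𝓘(ℝ, E).tangent X Y v : E × E) = 0 :=
      sub_eq_zero.2 (h X Y hX hY v)
    exact (congrArg Prod.snd (h1.symm.trans h2))
  · intro h X Y hX hY v
    have h1 := torsion_vranceanuCartan g hX hY v _ _ rfl rfl
    rw [h] at h1
    exact sub_eq_zero.1 h1

end Torsion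

/-! ### Geodesics from one chart, and their local existence. -/

section Geodesics

theorem christoffelSymbol_congr {F : Type*} [NormedAddCommGroup F] [NormedSpace ℝ F]
    {h k : F → F →L[ℝ] F →L[ℝ] ℝ} {u : F} (e : h =ᶠ[𝓝 u] k) :
    christoffelSymbol h u = christoffelSymbol k u := by
  rw [christoffelSymbol, christoffelSymbol, christoffelFirst, christoffelFirst, e.fderiv_eq,
    e.self_of_nhds]

variable {F : Type*} [NormedAddCommGroup F] [NormedSpace ℝ F] [FiniteDimensional ℝ F]
  {H : Type*} [TopologicalSpace H]
  {I : ModelWithCorners ℝ F H} [I.Boundaryless] {M : Type*} [TopologicalSpace M] [ChartedSpace H M]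
  [IsManifold I ∞ M] {G : ∀ q : M, TangentSpace I q →L[ℝ] TangentSpace I q →L[ℝ] ℝ}

/-- A solution of the geodesic equation in one chart is a geodesic. -/
theorem IsSmoothMetric.isGeodesicOn_of_chart (hG : IsSmoothMetric G) {p : M} {J : Set ℝ}
    (hJ : IsOpen J) {x y : ℝ → F} (hx : ∀ t ∈ J, HasDerivAt x (y t) t)
    (hy : ∀ t ∈ J, HasDerivAt y (-christoffel G p (x t) (y t) (y t)) t)
    (hm : ∀ t ∈ J, x t ∈ (extChartAt I p).target) :
    IsGeodesicOn G (fun t => (extChartAt I p).symm (x t)) J where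
  contMDiffOn := by
    have hxc : ContinuousOn x J := fun t ht => (hx t ht).continuousAt.continuousWithinAt
    have hyc : ContinuousOn y J := fun t ht => (hy t ht).continuousAt.continuousWithinAt
    have hΓ : ContinuousOn (fun t => -christoffel G p (x t) (y t) (y t)) J := by
      have h1 : ContinuousOn (fun t => christoffel G p (x t)) J := fun t ht =>
        (hG.contDiffAt_christoffel (hm t ht)).continuousAt.comp_continuousWithinAt (hxc t ht)
      exact ((h1.clm_apply hyc).clm_apply hyc).neg
    -- Bootstrap: the right-hand side of the equation is continuous, so y is C¹ and hence x is C².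
    have hy1 : ContDiffOn ℝ 1 y J := by
      rw [show (1 : ℕ∞ω) = 0 + 1 by norm_num, contDiffOn_succ_iff_deriv_of_isOpen hJ]
      refine ⟨fun t ht => (hy t ht).differentiableAt.differentiableWithinAt, by simp, ?_⟩
      exact contDiffOn_zero.2 (hΓ.congr fun t ht => (hy t ht).deriv)
    have hx2 : ContDiffOn ℝ 2 x J := by
      rw [show (2 : ℕ∞ω) = 1 + 1 by norm_num, contDiffOn_succ_iff_deriv_of_isOpen hJ]
      refine ⟨fun t ht => (hx t ht).differentiableAt.differentiableWithinAt, by simp, ?_⟩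
      exact hy1.congr fun t ht => (hx t ht).deriv
    exact ((contMDiffOn_extChartAt_symm (n := ∞) p).of_le ENat.LEInfty.out).comp
      hx2.contMDiffOn hm
  equation t ht := by
    set q := (extChartAt I p).symm (x t) with hq
    have hqs : (extChartAt I p).symm (x t) ∈ (extChartAt I q).source := mem_extChartAt_source q
    have hψ := contDiffAt_transition (hm t ht) hqs
    have hψ1 : ∀ᶠ z in 𝓝 (x t), DifferentiableAt ℝ (transition I p q) z := by
      filter_upwards [eventually_mem_target (hm t ht), eventually_symm_mem_source (hm t ht) hqs]
        with z h1 h2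
      exact (contDiffAt_transition h1 h2).differentiableAt (by simp)
    have hψ2 : DifferentiableAt ℝ (fderiv ℝ (transition I p q)) (x t) :=
      (hψ.fderiv_right (m := ∞) le_rfl).differentiableAt (by simp)
    -- The equation must hold in the chart centred at the current point: the second derivative of ψ
    -- ∘ x produces a D²ψ term, which the Christoffel law cancels.
    have e : deriv (fun s => extChartAt I q ((extChartAt I p).symm (x s))) =ᶠ[𝓝 t]
        fun s => fderiv ℝ (transition I p q) (x s) (y s) := by
      filter_upwards [hJ.mem_nhds ht, (hx t ht).continuousAt.eventually hψ1] with s h1 h2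
      exact (h2.hasFDerivAt.comp_hasDerivAt s (hx s h1)).deriv
    have d : HasDerivAt (fun s => fderiv ℝ (transition I p q) (x s) (y s))
        (fderiv ℝ (fderiv ℝ (transition I p q)) (x t) (y t) (y t)
          + fderiv ℝ (transition I p q) (x t) (-christoffel G p (x t) (y t) (y t))) t :=
      (hψ2.hasFDerivAt.comp_hasDerivAt t (hx t ht)).clm_apply (hy t ht)
    rw [e.deriv_eq, e.self_of_nhds, d.deriv]
    have h := hG.christoffel_transition (hm t ht) hqs (y t) (y t)
    rw [map_neg, h]
    have hc : extChartAt I q q = transition I p q (x t) := rfl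
    rw [hc]
    abel

/-- Local existence of geodesics with prescribed initial velocity. -/
theorem IsSmoothMetric.exists_isGeodesicOn (hG : IsSmoothMetric G) (p : M) (w : F) :
    ∃ ε > 0, ∃ γ : ℝ → M, IsGeodesicOn G γ (Set.Ioo (-ε) ε) ∧ γ 0 = p ∧
      deriv (fun s => extChartAt I p (γ s)) 0 = w := by
  have : CompleteSpace F := FiniteDimensional.complete ℝ F
  have hp := mem_extChartAt_target (I := I) p
  set u := extChartAt I p p with hu
  -- The geodesic equation as a first-order system for (x, x') with C¹ right-hand side, to which
  -- Picard–Lindelöf applies.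
  have hf : ContDiffAt ℝ 1 (fun z : F × F => (z.2, -christoffel G p z.1 z.2 z.2)) (u, w) := by
    have h1 : ContDiffAt ℝ 1 (christoffel G p) (u, w).1 :=
      (hG.contDiffAt_christoffel hp).of_le ENat.LEInfty.out
    exact contDiffAt_snd.prodMk
      (((h1.comp (u, w) contDiffAt_fst).clm_apply contDiffAt_snd).clm_apply contDiffAt_snd).neg
  obtain ⟨r, hr, ε, hε, hsol⟩ :=
    hf.exists_forall_mem_closedBall_exists_eq_forall_mem_Ioo_hasDerivAt 0
  obtain ⟨α, hα0, hα⟩ := hsol _ (Metric.mem_closedBall_self hr.le)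
  simp only [zero_sub, zero_add] at hα
  have hx : ∀ t ∈ Set.Ioo (-ε) ε, HasDerivAt (fun s => (α s).1) (α t).2 t :=
    fun t ht => (hα t ht).fst
  have hy : ∀ t ∈ Set.Ioo (-ε) ε, HasDerivAt (fun s => (α s).2)
      (-christoffel G p (α t).1 (α t).2 (α t).2) t := fun t ht => (hα t ht).snd
  have h0 : (0 : ℝ) ∈ Set.Ioo (-ε) ε := ⟨by linarith, hε⟩
  -- The solution may leave the chart, so the time interval is shrunk by continuity.
  have hev : ∀ᶠ t in 𝓝 (0 : ℝ), (α t).1 ∈ (extChartAt I p).target := by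
    refine (hx 0 h0).continuousAt.eventually (eventually_mem_target ?_)
    simpa [hα0] using hp
  obtain ⟨δ, hδ, hball⟩ := Metric.eventually_nhds_iff_ball.1 hev
  have hsub : Set.Ioo (-(min ε δ)) (min ε δ) ⊆ Set.Ioo (-ε) ε := by
    intro t ht
    exact ⟨by linarith [ht.1, min_le_left ε δ], ht.2.trans_le (min_le_left ε δ)⟩
  have hm : ∀ t ∈ Set.Ioo (-(min ε δ)) (min ε δ), (α t).1 ∈ (extChartAt I p).target := by
    intro t ht
    refine hball t ?_
    rw [Metric.mem_ball, Real.dist_eq, sub_zero, abs_lt]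
    exact ⟨by linarith [ht.1, min_le_right ε δ], ht.2.trans_le (min_le_right ε δ)⟩
  refine ⟨min ε δ, lt_min hε hδ, fun t => (extChartAt I p).symm (α t).1,
    hG.isGeodesicOn_of_chart isOpen_Ioo (fun t ht => hx t (hsub ht)) (fun t ht => hy t (hsub ht))
      hm, ?_, ?_⟩
  · simp only [hα0]
    exact extChartAt_to_inv p
  · have e : (fun s => extChartAt I p ((extChartAt I p).symm (α s).1)) =ᶠ[𝓝 0]
        fun s => (α s).1 := by
      filter_upwards [hev] with s hs
      exact (extChartAt I p).right_inv hs
    rw [e.deriv_eq, (hx 0 h0).deriv, hα0]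

end Geodesics

/-! ### Projections of Sasaki geodesics. -/

section Projection

variable {E : Type*} [NormedAddCommGroup E] [NormedSpace ℝ E] [FiniteDimensional ℝ E]
  {N : Type*} [TopologicalSpace N] [ChartedSpace E N] [IsManifold 𝓘(ℝ, E) ∞ N]
  (g : RiemMetric E N)

/-- The left-hand side of the geodesic equation for the projection of a Sasaki geodesic is
determined by the curvature of the horizontal distribution. -/
theorem projection_geodesic_equation {γ : ℝ → TangentBundle 𝓘(ℝ, E) N} {J : Set ℝ}
    (hJ : IsOpen J) (hγ : IsGeodesicOn (sasakiMetric g) γ J) {t : ℝ} (ht : t ∈ J) (c : E) :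
    metricInChart g.inner (γ t).proj (xyCoords (γ t)).1
      (deriv (deriv (fun s => extChartAt 𝓘(ℝ, E) (γ t).proj (γ s).proj)) t
        + christoffel g.inner (γ t).proj (extChartAt 𝓘(ℝ, E) (γ t).proj (γ t).proj)
          (deriv (fun s => extChartAt 𝓘(ℝ, E) (γ t).proj (γ s).proj) t)
          (deriv (fun s => extChartAt 𝓘(ℝ, E) (γ t).proj (γ s).proj) t)) c
      + metricInChart g.inner (γ t).proj (xyCoords (γ t)).1
        (deltaForm (christoffel g.inner (γ t).proj) (xyCoords (γ t))
          (deriv (fun s => extChartAt 𝓘(ℝ, E).tangent (γ t) (γ s)) t))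
        (horizontalCurvature (christoffel g.inner (γ t).proj) (xyCoords (γ t))
          (deriv (fun s => extChartAt 𝓘(ℝ, E).tangent (γ t) (γ s)) t).1 c) = 0 := by
  set v := γ t with hv
  have hu : xyCoords v ∈ (extChartAt 𝓘(ℝ, E).tangent v).target := mem_extChartAt_target v
  have hu1 := (mem_tangentChart_target v _).1 hu
  let k : ℝ → E × E := fun s => extChartAt 𝓘(ℝ, E).tangent v (γ s)
  have hk : ContDiffAt ℝ 2 k t := by
    have h1 : ContMDiffAt 𝓘(ℝ, E).tangent 𝓘(ℝ, E × E) 2 (extChartAt 𝓘(ℝ, E).tangent v) (γ t) :=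
      contMDiffAt_extChartAt.of_le (n := ∞) ENat.LEInfty.out
    exact (h1.comp t (hγ.contMDiffOn.contMDiffAt (hJ.mem_nhds ht))).contDiffAt
  have hk1 : ∀ᶠ s in 𝓝 t, DifferentiableAt ℝ k s :=
    (hk.eventually (by simp)).mono fun s hs => hs.differentiableAt (by simp)
  have hk2 : DifferentiableAt ℝ (deriv k) t := by
    have h1 := (hk.fderiv_right (m := 1) (by norm_num)).differentiableAt one_ne_zero
    exact (h1.clm_apply (differentiableAt_const (1 : ℝ)))
  have fst_deriv : ∀ {f : ℝ → E × E} {s : ℝ}, DifferentiableAt ℝ f s →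
      HasDerivAt (fun r => (f r).1) (deriv f s).1 s := fun h => h.hasDerivAt.fst
  -- The first component of the induced chart at v is the base chart at its foot point.
  have e1 : deriv (fun s => extChartAt 𝓘(ℝ, E) v.proj (γ s).proj) =ᶠ[𝓝 t]
      fun s => (deriv k s).1 := by
    filter_upwards [hk1] with s hs
    exact (fst_deriv hs).deriv
  have e2 := hγ.equation t ht
  have e3 : christoffel (sasakiMetric g) v (extChartAt 𝓘(ℝ, E).tangent v v) = christoffelSymbol
      (sasakiForm (metricInChart g.inner v.proj) (christoffel g.inner v.proj)) (xyCoords v) := by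
    refine christoffelSymbol_congr ?_
    filter_upwards [eventually_mem_target (I := 𝓘(ℝ, E).tangent) hu] with z hz
    exact metricInChart_sasaki g hz
  rw [← hv, e3] at e2
  rw [e1.deriv_eq, e1.self_of_nhds, (fst_deriv hk2).deriv]
  exact sasakiForm_geodesic
    (((isSmoothMetric_inner g).contDiffAt hu1).of_le ENat.LEInfty.out)
    (Eventually.of_forall (metricInChart_symm g v.proj)) (fun a => metricInChart_pos g hu1)
    (deriv k t) (deriv (deriv k) t) e2 c

omit [FiniteDimensional ℝ E] in
theorem metricInChart_eq_zero {p : N} {u a : E} (hu : u ∈ (extChartAt 𝓘(ℝ, E) p).target)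
    (h : metricInChart g.inner p u a a = 0) : a = 0 := by
  by_contra ha
  exact (metricInChart_pos g hu ha).ne' h

theorem projectionTotallyGeodesic_iff :
    ProjectionTotallyGeodesic g ↔ ∀ (v : TangentBundle 𝓘(ℝ, E) N) (a c : E),
      horizontalCurvature (christoffel g.inner v.proj) (xyCoords v) a c = 0 := by
  constructor
  · intro h v a c
    -- The fibre component of the initial velocity is chosen so that δy takes the value R(a,c) on
    -- it; the equation tested on c then reads |R(a,c)|² = 0.
    obtain ⟨ε, hε, γ, hγ, rfl, hw⟩ := (isSmoothMetric_sasakiMetric g).exists_isGeodesicOn v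
      ((a, horizontalCurvature (christoffel g.inner v.proj) (xyCoords v) a c
        - connectionCoeff (christoffel g.inner v.proj) (xyCoords v) a) : E × E)
    have h0 : (0 : ℝ) ∈ Set.Ioo (-ε) ε := ⟨by linarith, hε⟩
    have h1 := projection_geodesic_equation g isOpen_Ioo hγ h0 c
    rw [(h _ γ isOpen_Ioo Set.ordConnected_Ioo hγ).equation 0 h0, hw] at h1
    rw [map_zero, zero_apply, zero_add, deltaForm_apply, sub_add_cancel] at h1
    exact metricInChart_eq_zero g (mem_extChartAt_target (γ 0).proj) h1
  · intro h J γ hJ _ hγ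
    refine ⟨fun t ht => ?_, fun t ht => ?_⟩
    · exact (Bundle.contMDiff_proj (TangentSpace 𝓘(ℝ, E) : N → Type _)
        _).comp_contMDiffWithinAt t (hγ.contMDiffOn t ht)
    -- Without curvature the geodesic expression is orthogonal to every c, in particular to itself.
    · refine metricInChart_eq_zero g (mem_extChartAt_target (γ t).proj) ?_
      have h1 := projection_geodesic_equation g hJ hγ ht
      simp only [h, map_zero, add_zero] at h1
      exact h1 _

end Projection

end SasakiVranceanu

end

theorem corollary3p12 {E : Type*} [NormedAddCommGroup E] [NormedSpace ℝ E]
    [FiniteDimensional ℝ E] {N : Type*} [TopologicalSpace N] [T2Space N] [ChartedSpace E N]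
    [IsManifold 𝓘(ℝ, E) ∞ N] (g : SasakiVranceanu.RiemMetric E N) :
    SasakiVranceanu.ProjectionTotallyGeodesic g ↔
      SasakiVranceanu.IsTorsionFree (SasakiVranceanu.vranceanuCartan g) := by
  rw [SasakiVranceanu.projectionTotallyGeodesic_iff, SasakiVranceanu.isTorsionFree_iff]
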